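/- **Setting.** Let $\mathbb F$ be a finite ranked alphabet, $\mathcal R$ a finite non-empty set of rewrite rules $\ell\to r$ over $\mathbb F$ ($\ell$ is not a variable, every variable of $r$ occurs in $\ell$, and $\ell$ need not be linear), and $\mathcal L$ its set of left-hand sides. Positions are lists of argument places, $p.q$ is concatenation, $p\le q$ means that $p$ is a prefix of $q$, and $x@p$ denotes the pair $(x,p)$. $\mathrm{hd}$ denotes the head symbol, $\mathcal E(\ell)$ the set of positions at which $\ell$ has a variable, and $\pi(\ell)$ the partition of $\mathcal E(\ell)$ into the classes of positions carrying the same variable; $t$ is *consistent* with $\pi(\ell)$ if $t|_p=t|_q$ for all $P\in\pi(\ell)$ and $p,q\in P$. A pattern $\ell$ is *linear* if $|\pi(\ell)|=|\mathcal E(\ell)|$, and *non-linear* if $|\pi(\ell)|<|\mathcal E(\ell)|$. A rule at a position, $(\ell\to r)@p$, is a *redex* of $t$ if $t|_p=\ell^\sigma$ for some substitution $\sigma$; then $t[(\ell\to r)@p]$ is the term obtained from $t$ by replacing the subterm at $p$ by $r^\sigma$. The induced rewrite relation is $\to$. A term is *in normal form* if it has no redexes, and $t$ is a *normal form of $t_0$*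 if $t_0\to^* t$ and $t$ is in normal form. **Set automaton.** A *match goal* $mo\hookrightarrow\ell@p$ consists of a finite set $mo$ of pairs $\ell'@p'$ (the obligation) and an announcement $\ell@p$ with $\ell\in\mathcal L$; it is a *root goal* if $p=\epsilon$. Let $\mathrm{pos}(mo)$ be the set of positions in $mo$. States are sets of match goals. The initial state is $s_0=\{\ell@\epsilon\hookrightarrow\ell@\epsilon\mid\ell\in\mathcal L\}$. Each state $s$ carries a label $L(s)\in\mathrm{pos}(mo)$ for some root goal $mo\hookrightarrow ma\in s$, chosen arbitrarily. Let $$\mathrm{reduce}(mo,f,p)=\{\ell@q\in mo\mid q\ne p\}\cup\{\ell|_i@p.i\mid \ell@p\in mo,\ 1\le i\le \#f,\ \ell|_i\text{ not a variable}\}.$$ The $f$-derivative of $s$ consists of the goals $\mathrm{reduce}(mo,f,L(s))\hookrightarrow ma$ with $mo\hookrightarrow ma\in s$, $\ell'@L(s)\in mo$ for some $\ell'$ with head $f$, and $\mathrm{reduce}(mo,f,L(s))\neq\emptyset$; the goals $mo\hookrightarrow ma\in s$ with $L(s)\notin \mathrm{pos}(mo)$; and the goals $\ell@L(s).i\hookrightarrow\ell@L(s).i$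 for $\ell\in\mathcal L$, $1\le i\le\#f$. It is partitioned by the transitive closure of "the obligations share a position". Then $\delta(s,f)$ is the set of pairs $(\mathrm{lift}(K),\mathrm{gcp}(K))$ for the classes $K$, where $\mathrm{gcp}(K)$ is the greatest common prefix of the announcement positions in $K$ and $\mathrm{lift}(K)$ is $K$ with this prefix removed from all positions. $S$ is the set of states reachable from $s_0$. Finally $\mathrm{out}(s,f)$ is the set of all $(\ell\to r)@q$ with $\ell\to r\in\mathcal R$ such that $s$ contains a goal $\{f(x_1,\dots,x_n)@L(s)\}\hookrightarrow \ell@q$ with $x_1,\dots,x_n$ variables; $\mathrm{out}_L$ and $\mathrm{out}_{NL}$ are its restrictions to rules with linear and with non-linear $\ell$. For $X\in\{L,NL\}$ put $\mathrm{matches}_X(s,p,t)=\{(\ell\to r)@p.q\mid(\ell\to r)@q\in\mathrm{out}_X(s,\mathrm{hd}(t|_{p.L(s)}))\}$. **Configuration trees** are generated by $ct::=\mathrm{bud}(s,p)\mid\mathrm{node}(s,p,cts)$ with $cts$ a finite set of trees. $\mathrm{grow}(ct,s,p,t)$ replaces each $\mathrm{bud}(s,p)$ by $\mathrm{node}(s,p,\{\mathrm{bud}(s',p.p')\mid(s',p')\in\delta(s,\mathrm{hd}(t|_{p.L(s)}))\})$.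 $\mathrm{prune}(ct,q)$ replaces each topmost subtree $\mathrm{node}(s,p,cts)$ with $p.L(s)=q$ by $\mathrm{bud}(s,p)$. $ct[p]$ is the subtree whose root configuration $(s,q)$ satisfies $q.L(s)=p$; $\mathrm{buds}(ct)$ and $\mathrm{nodes}(ct)$ are the sets of bud- and node-labelled configurations $(s,p)$. **Procedure NormalizeNonLinear$(t_0,\mathrm{select})$.** Start with $t=t_0$, $reds_L=am=dis=en=\emptyset$, $ct=\mathrm{bud}(s_0,\epsilon)$. While $\mathrm{buds}(ct)$, $reds_L$, $en$, $am$ are not all empty, let the strategy $\mathrm{select}$ choose an element of $\mathrm{buds}(ct)\cup am\cup(reds_L\cup en)$. * If it is $(s,p)\in\mathrm{buds}(ct)$: replace $ct$ by $\mathrm{grow}(ct,s,p,t)$, and add $\mathrm{matches}_L(s,p,t)$ to $reds_L$ and $\mathrm{matches}_{NL}(s,p,t)$ to $am$. * Else, if it is $(\ell\to r)@p\in am$: remove it from $am$ and add it to $en$ if $t|_p$ is consistent with $\pi(\ell)$, and to $dis$ otherwise. * Else, it is $(\ell\to r)@p\in reds_L\cup en$: remove $\bigcup\{\mathrm{matches}_L(s,q,t)\mid(s,q)\in\mathrm{nodes}(ct[p])\}$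 from $reds_L$ and $\bigcup\{\mathrm{matches}_{NL}(s,q,t)\mid(s,q)\in\mathrm{nodes}(ct[p])\}$ from each of $en$, $dis$ and $am$; then move from $en\cup dis$ to $am$ all $(\ell'\to r')@q$ for which there are $P\in\pi(\ell')$ with $|P|\ge2$ and $q'\in P$ with $q.q'\le p$; then replace $ct$ by $\mathrm{prune}(ct,p)$ and $t$ by $t[(\ell\to r)@p]$. When the loop ends, return $t$. **Corollary (partial correctness).** For every ground term $t_0$, every choice of the state labels and every strategy $\mathrm{select}$: if NormalizeNonLinear$(t_0,\mathrm{select})$ returns $t$, then $t$ is a normal form of $t_0$, that is, $t_0\to^*t$ and $t$ is in normal form. -/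

import Mathlib

universe u v w x

/-! ## Terms, positions and rewriting

A ranked alphabet is a first-order language `𝓛` with finitely many function symbols (its relation
symbols play no role), and the terms over it with variables in `V` are `𝓛.Term V`. -/

namespace SetAutomata

open scoped Classical in
section

variable {𝓛 : FirstOrder.Language.{u, v}} {V : Type w} {S : Type x}

/-- A function symbol together with its arity `f.1`. -/
abbrev Symb (𝓛 : FirstOrder.Language.{u, v}) : Type u := Σ n, 𝓛.Functions n

/-- Positions. The argument places of a symbol of arity `n` are numbered `0, …, n - 1`
(instead of `1, …, n`). The root position is `[]`, concatenation is `++`, and `p <+: q` says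
that `p` is a prefix of `q`, that is, `p ≤ q`. -/
abbrev Position : Type := List ℕ

/-- The subterm `t|_p`; it is `none` if `p` is not in the domain of `t`. -/
def subAt : 𝓛.Term V → Position → Option (𝓛.Term V)
  | t, [] => some t
  | .var _, _ :: _ => none
  | .func (l := n) _ ts, i :: p => if h : i < n then subAt (ts ⟨i, h⟩) p else none

/-- The term domain `𝒟(t)`. -/
def dom (t : 𝓛.Term V) : Set Position := {p | ∃ u, subAt t p = some u}

/-- The edge `ℰ(t)`: the positions at which `t` has a variable. -/
def edge (t : 𝓛.Term V) : Set Position := {p | ∃ y, subAt t p = some (.var y)}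

/-- `t[u]_p` (and `t` itself if `p` is not in the domain of `t`). -/
def replaceAt : 𝓛.Term V → Position → 𝓛.Term V → 𝓛.Term V
  | _, [], u => u
  | .var y, _ :: _, _ => .var y
  | .func (l := n) f ts, i :: p, u =>
      .func f (fun j : Fin n => if (j : ℕ) = i then replaceAt (ts j) p u else ts j)

/-- The head symbol of a term; variables have none. -/
def hd : 𝓛.Term V → Option (Symb 𝓛)
  | .var _ => none
  | .func f _ => some ⟨_, f⟩

/-- The head symbol `hd(t|_p)`. -/
def headAt (t : 𝓛.Term V) (p : Position) : Option (Symb 𝓛) := (subAt t p).bind hd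

/-- The set of variables `vars(t)`. -/
noncomputable def vars (t : 𝓛.Term V) : Finset V := t.varFinset

/-- A ground term has no variables. -/
def IsGround (t : 𝓛.Term V) : Prop := vars t = ∅

/-- A pattern is a term that is not a variable. -/
def IsPattern (t : 𝓛.Term V) : Prop := ∀ y, t ≠ .var y

/-- A rewrite rule `lhs → rhs`. The left-hand side need not be linear. -/
structure Rule (𝓛 : FirstOrder.Language.{u, v}) (V : Type w) where
  lhs : 𝓛.Term V
  rhs : 𝓛.Term V
  isPattern_lhs : IsPattern lhs
  vars_rhs_subset : vars rhs ⊆ vars lhs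

/-- A term rewrite system: a finite, non-empty set of rewrite rules. -/
structure TRS (𝓛 : FirstOrder.Language.{u, v}) (V : Type w) where
  rules : Finset (Rule 𝓛 V)
  nonempty : rules.Nonempty

/-- A pair `(ℓ → r)@p`. -/
abbrev RuleAt (𝓛 : FirstOrder.Language.{u, v}) (V : Type w) := Rule 𝓛 V × Position

/-- `t` matches `ℓ`. -/
def Matches (t ℓ : 𝓛.Term V) : Prop := ∃ σ : V → 𝓛.Term V, t = ℓ.subst σ

/-- `(ℓ → r)@p` is a redex of `t`: the subterm `t|_p` exists and matches `ℓ`. -/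
def IsRedex (t : 𝓛.Term V) (ρ : Rule 𝓛 V) (p : Position) : Prop :=
  ∃ u, subAt t p = some u ∧ Matches u ρ.lhs

/-- `t` rewrites to `t'` by the rule `ρ` at position `p`. -/
def RewritesAt (ρ : Rule 𝓛 V) (p : Position) (t t' : 𝓛.Term V) : Prop :=
  ∃ (u : 𝓛.Term V) (σ : V → 𝓛.Term V), p ∈ dom u ∧
    t = replaceAt u p (ρ.lhs.subst σ) ∧ t' = replaceAt u p (ρ.rhs.subst σ)

/-- `t` rewrites to `t'` by some rule of `R` at some position. -/
def TRS.Rewrites (R : TRS 𝓛 V) (t t' : 𝓛.Term V) : Prop :=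
  ∃ ρ ∈ R.rules, ∃ p, RewritesAt ρ p t t'

/-- `t` has no redexes. -/
def TRS.InNormalForm (R : TRS 𝓛 V) (t : 𝓛.Term V) : Prop :=
  ∀ ρ ∈ R.rules, ∀ p, ¬ IsRedex t ρ p

/-- `t` is a normal form of `t₀`: it is in normal form and `t₀` rewrites to it in zero or more
steps. -/
def TRS.IsNormalFormOf (R : TRS 𝓛 V) (t t₀ : 𝓛.Term V) : Prop :=
  Relation.ReflTransGen R.Rewrites t₀ t ∧ R.InNormalForm t

/-- `t[(ℓ → r)@p]`: the unique `t'` such that `t` rewrites to `t'` by `ℓ → r` at `p`.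
If `(ℓ → r)@p` is not a redex of `t`, it is an unspecified term. -/
noncomputable def contract (t : 𝓛.Term V) (ρ : Rule 𝓛 V) (p : Position) : 𝓛.Term V :=
  @Classical.epsilon _ ⟨t⟩ (fun t' => RewritesAt ρ p t t')

/-- The set `ℒ` of left-hand sides. -/
noncomputable def TRS.lhss (R : TRS 𝓛 V) : Finset (𝓛.Term V) := R.rules.image Rule.lhs

/-! ### Variable partitions and consistency -/

/-- `π(ℓ)`: the partition of `ℰ(ℓ)` into the sets of positions that carry the same variable. -/
def varPartition (ℓ : 𝓛.Term V) : Set (Set Position) :=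
  {P | ∃ p ∈ edge ℓ, P = {q | q ∈ edge ℓ ∧ subAt ℓ q = subAt ℓ p}}

/-- `|π(ℓ)| = |ℰ(ℓ)|`. -/
def IsLinear (ℓ : 𝓛.Term V) : Prop := (varPartition ℓ).ncard = (edge ℓ).ncard

/-- `|π(ℓ)| < |ℰ(ℓ)|`. -/
def IsNonLinear (ℓ : 𝓛.Term V) : Prop := (varPartition ℓ).ncard < (edge ℓ).ncard

/-- `t` is consistent with `π(ℓ)`. -/
def IsConsistent (t ℓ : 𝓛.Term V) : Prop :=
  ∀ P ∈ varPartition ℓ, ∀ p ∈ P, ∀ q ∈ P, subAt t p = subAt t q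

/-! ## Set automata -/

/-- A set automaton with states `S` (finiteness of `S` is not recorded: no definition below needs
it). The output function yields patterns at positions. -/
structure SetAutomaton (𝓛 : FirstOrder.Language.{u, v}) (V : Type w) (S : Type x) where
  init : S
  label : S → Position
  trans : S → Symb 𝓛 → Finset (S × Position)
  out : S → Symb 𝓛 → Set (𝓛.Term V × Position)

/-- A non-linear set automaton with states `S`. The two output functions yield rewrite rules
at positions. -/
structure NonLinearSetAutomaton (𝓛 : FirstOrder.Language.{u, v}) (V : Type w) (S : Type x) where
  init : S
  label : S → Position
  trans : S → Symb 𝓛 → Finset (S × Position)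
  outL : S → Symb 𝓛 → Set (RuleAt 𝓛 V)
  outNL : S → Symb 𝓛 → Set (RuleAt 𝓛 V)

/-- The non-linear set automaton obtained from a set automaton for the left-hand sides of `R`. -/
def SetAutomaton.toNonLinear (M : SetAutomaton 𝓛 V S) (R : TRS 𝓛 V) :
    NonLinearSetAutomaton 𝓛 V S where
  init := M.init
  label := M.label
  trans := M.trans
  outL s f := {a | a.1 ∈ R.rules ∧ (a.1.lhs, a.2) ∈ M.out s f ∧ IsLinear a.1.lhs}
  outNL s f := {a | a.1 ∈ R.rules ∧ (a.1.lhs, a.2) ∈ M.out s f ∧ IsNonLinear a.1.lhs}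

/-! ### Construction of the set automaton of a TRS -/

/-- Match obligations: finite sets of pairs `ℓ@p`. -/
abbrev Obligation (𝓛 : FirstOrder.Language.{u, v}) (V : Type w) := Finset (𝓛.Term V × Position)

/-- Match goals `mo ↪ ℓ@p`: a match obligation paired with a match announcement. -/
abbrev Goal (𝓛 : FirstOrder.Language.{u, v}) (V : Type w) := Obligation 𝓛 V × (𝓛.Term V × Position)

/-- States are encoded as sets of match goals. -/
abbrev GoalSet (𝓛 : FirstOrder.Language.{u, v}) (V : Type w) := Finset (Goal 𝓛 V)

/-- The set of positions in a match obligation. -/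
noncomputable def Obligation.pos (mo : Obligation 𝓛 V) : Finset Position := mo.image Prod.snd

/-- The fresh goal `ℓ@p ↪ ℓ@p`. -/
noncomputable def freshGoal (ℓ : 𝓛.Term V) (p : Position) : Goal 𝓛 V := ({(ℓ, p)}, (ℓ, p))

/-- The arguments of `ℓ` at the argument places of `f` that are not variables, with their
argument places. -/
noncomputable def patternArgs (ℓ : 𝓛.Term V) (f : Symb 𝓛) : Finset (𝓛.Term V × ℕ) :=
  (Finset.range f.1).biUnion fun i =>
    ((subAt ℓ [i]).toFinset.filter IsPattern).image fun u => (u, i)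

/-- `reduce(mo, f, p)`. -/
noncomputable def reduce (mo : Obligation 𝓛 V) (f : Symb 𝓛) (p : Position) : Obligation 𝓛 V :=
  mo.filter (fun a => a.2 ≠ p) ∪
    (mo.filter (fun a => a.2 = p)).biUnion fun a =>
      (patternArgs a.1 f).image fun b => (b.1, p ++ [b.2])

/-- The `f`-derivative of the state `s` with state label `p`. -/
noncomputable def deriv (R : TRS 𝓛 V) (s : GoalSet 𝓛 V) (p : Position) (f : Symb 𝓛) :
    GoalSet 𝓛 V :=
  ((s.filter fun g => (∃ ℓ, (ℓ, p) ∈ g.1 ∧ hd ℓ = some f) ∧ reduce g.1 f p ≠ ∅).image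
      fun g => (reduce g.1 f p, g.2)) ∪
    (s.filter fun g => p ∉ Obligation.pos g.1) ∪
    (R.lhss ×ˢ Finset.range f.1).image fun a => freshGoal a.1 (p ++ [a.2])

/-- Direct dependency of match goals. -/
def DirectDep (g h : Goal 𝓛 V) : Prop := (Obligation.pos g.1 ∩ Obligation.pos h.1).Nonempty

/-- The equivalence class of `g` in `s` for the dependency relation on `s`, the reflexive
transitive closure of direct dependency among the goals of `s`. -/
noncomputable def depClass (s : GoalSet 𝓛 V) (g : Goal 𝓛 V) : GoalSet 𝓛 V :=
  s.filter fun h => Relation.ReflTransGen (fun a b => a ∈ s ∧ b ∈ s ∧ DirectDep a b) g h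

/-- The set of equivalence classes of `s` for the dependency relation. -/
noncomputable def depClasses (s : GoalSet 𝓛 V) : Finset (GoalSet 𝓛 V) := s.image (depClass s)

/-- `q` is the greatest common prefix of the match announcement positions of `K`. -/
def IsGcp (K : GoalSet 𝓛 V) (q : Position) : Prop :=
  (∀ g ∈ K, q <+: g.2.2) ∧ ∀ q' : Position, (∀ g ∈ K, q' <+: g.2.2) → q' <+: q

/-- The greatest common prefix of the match announcement positions of a non-empty `K`. -/
noncomputable def gcp (K : GoalSet 𝓛 V) : Position := Classical.epsilon (IsGcp K)

/-- Removing the prefix `q` from all positions of a match obligation. -/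
noncomputable def liftObligation (q : Position) (mo : Obligation 𝓛 V) : Obligation 𝓛 V :=
  (mo.filter fun a => q <+: a.2).image fun a => (a.1, a.2.drop q.length)

/-- `lift(K)`: removing the prefix `gcp(K)` from all positions of `K`. -/
noncomputable def lift (K : GoalSet 𝓛 V) : GoalSet 𝓛 V :=
  (K.filter fun g => gcp K <+: g.2.2).image fun g =>
    (liftObligation (gcp K) g.1, (g.2.1, g.2.2.drop (gcp K).length))

/-- The initial state: all fresh root goals. -/
noncomputable def initGoals (R : TRS 𝓛 V) : GoalSet 𝓛 V := R.lhss.image fun ℓ => freshGoal ℓ []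

/-- `δ(s, f)`, for the state labelling `lab`. -/
noncomputable def transGoals (R : TRS 𝓛 V) (lab : GoalSet 𝓛 V → Position) (s : GoalSet 𝓛 V)
    (f : Symb 𝓛) : Finset (GoalSet 𝓛 V × Position) :=
  (depClasses (deriv R s (lab s) f)).image fun K => (lift K, gcp K)

/-- The output patterns `out(s, f)`: the announcements of the goals whose obligation is
`f(x₁, …, xₙ)@L(s)` for variables `x₁, …, xₙ` (not necessarily distinct). -/
def outGoals (lab : GoalSet 𝓛 V → Position) (s : GoalSet 𝓛 V) (f : Symb 𝓛) :
    Set (𝓛.Term V × Position) :=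
  {ma | ∃ xs : Fin f.1 → V, (({(.func f.2 fun i => .var (xs i), lab s)} : Obligation 𝓛 V), ma) ∈ s}

/-- The states that are reachable from the initial state. -/
inductive Reachable (R : TRS 𝓛 V) (lab : GoalSet 𝓛 V → Position) : GoalSet 𝓛 V → Prop
  | init : Reachable R lab (initGoals R)
  | trans {s s' : GoalSet 𝓛 V} {f : Symb 𝓛} {q : Position} (hs : Reachable R lab s)
      (h : (s', q) ∈ transGoals R lab s f) : Reachable R lab s'

/-- `p` is an obligation position of a root goal of `s`. -/
def IsRootPosition (s : GoalSet 𝓛 V) (p : Position) : Prop :=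
  ∃ g ∈ s, g.2.2 = [] ∧ p ∈ Obligation.pos g.1

/-- `lab` labels every state by an obligation position of one of its root goals. That every
reachable state has such a position is not part of this condition. -/
def IsLabelling (R : TRS 𝓛 V) (lab : GoalSet 𝓛 V → Position) : Prop :=
  ∀ s, Reachable R lab s → (∃ p, IsRootPosition s p) → IsRootPosition s (lab s)

/-- The states of the constructed set automaton: all reachable states. -/
abbrev State (R : TRS 𝓛 V) (lab : GoalSet 𝓛 V → Position) := {s : GoalSet 𝓛 V // Reachable R lab s}

/-- The set automaton that is constructed for the left-hand sides of `R`, for the chosen state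
labelling `lab`. -/
noncomputable def TRS.setAutomaton (R : TRS 𝓛 V) (lab : GoalSet 𝓛 V → Position) :
    SetAutomaton 𝓛 V (State R lab) where
  init := ⟨initGoals R, .init⟩
  label s := lab s.1
  trans s f := (transGoals R lab s.1 f).attach.image fun a => (⟨a.1.1, s.2.trans a.2⟩, a.1.2)
  out s f := outGoals lab s.1 f

/-- The non-linear set automaton that is constructed for `R`. -/
noncomputable def TRS.nonLinearSetAutomaton (R : TRS 𝓛 V) (lab : GoalSet 𝓛 V → Position) :
    NonLinearSetAutomaton 𝓛 V (State R lab) :=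
  (R.setAutomaton lab).toNonLinear R

/-! ## Configuration trees -/

/-- Configurations `(s, p)`. -/
abbrev Conf (S : Type x) := S × Position

/-- Configuration trees. The finite set of successor trees of a node is given as a family that is
indexed by the configurations at the roots of these trees. -/
inductive ConfTree (S : Type x) : Type x
  | bud (c : Conf S) : ConfTree S
  | node (c : Conf S) (succs : Finset (Conf S)) (cts : {d // d ∈ succs} → ConfTree S) : ConfTree S

namespace ConfTree

/-- The configuration at the root. -/
def root : ConfTree S → Conf S
  | bud c => c
  | node c _ _ => c

/-- The set of bud-labelled configurations. -/
def buds : ConfTree S → Set (Conf S)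
  | bud c => {c}
  | node _ _ cts => ⋃ d, buds (cts d)

/-- The set of node-labelled configurations. -/
def nodes : ConfTree S → Set (Conf S)
  | bud _ => ∅
  | node c _ cts => {c} ∪ ⋃ d, nodes (cts d)

/-- The set of subtrees, the tree itself included. -/
def subtrees : ConfTree S → Set (ConfTree S)
  | bud c => {bud c}
  | node c succs cts => {node c succs cts} ∪ ⋃ d, subtrees (cts d)

end ConfTree

namespace NonLinearSetAutomaton

variable (M : NonLinearSetAutomaton 𝓛 V S)

/-- The position `p.L(s)` that is inspected in the configuration `(s, p)`. -/
def inspected (c : Conf S) : Position := c.2 ++ M.label c.1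

/-- The successor configurations of `(s, p)` for the term `t`. -/
noncomputable def successors (c : Conf S) (t : 𝓛.Term V) : Finset (Conf S) :=
  match headAt t (M.inspected c) with
  | some f => (M.trans c.1 f).image fun d => (d.1, c.2 ++ d.2)
  | none => ∅

/-- `grow(ct, s, p, t)`, for `c = (s, p)`. -/
noncomputable def grow (c : Conf S) (t : 𝓛.Term V) : ConfTree S → ConfTree S
  | .bud d => if d = c then .node c (M.successors c t) fun e => .bud e.1 else .bud d
  | .node d succs cts => .node d succs fun e => grow c t (cts e)

/-- `prune(ct, q)`. -/
noncomputable def prune (q : Position) : ConfTree S → ConfTree S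
  | .bud d => .bud d
  | .node d succs cts =>
      if M.inspected d = q then .bud d else .node d succs fun e => prune q (cts e)

/-- `nodes(ct[p])`, where `ct[p]` is the subtree of `ct` whose root configuration inspects `p`
(the empty set if there is no such subtree). -/
def nodesBelow (ct : ConfTree S) (p : Position) : Set (Conf S) :=
  ⋃ ct' ∈ {ct' | ct' ∈ ct.subtrees ∧ M.inspected ct'.root = p}, ct'.nodes

/-- `matches_L(s, p, t)`, for `c = (s, p)`. -/
def matchesL (c : Conf S) (t : 𝓛.Term V) : Set (RuleAt 𝓛 V) :=
  {a | ∃ f, headAt t (M.inspected c) = some f ∧ ∃ q, (a.1, q) ∈ M.outL c.1 f ∧ a.2 = c.2 ++ q}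

/-- `matches_NL(s, p, t)`, for `c = (s, p)`. -/
def matchesNL (c : Conf S) (t : 𝓛.Term V) : Set (RuleAt 𝓛 V) :=
  {a | ∃ f, headAt t (M.inspected c) = some f ∧ ∃ q, (a.1, q) ∈ M.outNL c.1 f ∧ a.2 = c.2 ++ q}

end NonLinearSetAutomaton

/-! ## The procedure NormalizeNonLinear -/

/-- The values of the program variables. -/
structure Memory (𝓛 : FirstOrder.Language.{u, v}) (V : Type w) (S : Type x) where
  t : 𝓛.Term V
  redsL : Set (RuleAt 𝓛 V)
  am : Set (RuleAt 𝓛 V)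
  dis : Set (RuleAt 𝓛 V)
  en : Set (RuleAt 𝓛 V)
  ct : ConfTree S

/-- An action is a configuration or a rule at a position. -/
abbrev Action (𝓛 : FirstOrder.Language.{u, v}) (V : Type w) (S : Type x) := Conf S ⊕ RuleAt 𝓛 V

/-- The set `buds(ct) ∪ am ∪ (reds_L ∪ en)` from which the strategy selects. -/
def Memory.pool (m : Memory 𝓛 V S) : Set (Action 𝓛 V S) :=
  Sum.inl '' m.ct.buds ∪ (Sum.inr '' m.am ∪ Sum.inr '' (m.redsL ∪ m.en))

/-- A strategy: a partial function that selects an element of the pool whenever the pool is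
non-empty. The choice may depend on the values of all program variables. -/
structure Strategy (𝓛 : FirstOrder.Language.{u, v}) (V : Type w) (S : Type x) where
  select : Memory 𝓛 V S → Option (Action 𝓛 V S)
  select_mem : ∀ m, m.pool.Nonempty → ∃ a ∈ m.pool, select m = some a

/-- The guard of the while loop. -/
def Memory.Guard (m : Memory 𝓛 V S) : Prop :=
  m.ct.buds.Nonempty ∨ m.redsL.Nonempty ∨ m.en.Nonempty ∨ m.am.Nonempty

namespace NonLinearSetAutomaton

variable (M : NonLinearSetAutomaton 𝓛 V S)

/-- The initial values of the program variables. -/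
def start (t₀ : 𝓛.Term V) : Memory 𝓛 V S where
  t := t₀
  redsL := ∅
  am := ∅
  dis := ∅
  en := ∅
  ct := .bud (M.init, [])

/-- The branch in which the selected action is a bud `c`. -/
noncomputable def growStep (m : Memory 𝓛 V S) (c : Conf S) : Memory 𝓛 V S :=
  { m with
    ct := M.grow c m.t m.ct
    redsL := m.redsL ∪ M.matchesL c m.t
    am := m.am ∪ M.matchesNL c m.t }

/-- The branch in which the selected action is an ambiguous match `a = (ℓ → r)@p`. -/
noncomputable def checkStep (m : Memory 𝓛 V S) (a : RuleAt 𝓛 V) : Memory 𝓛 V S :=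
  if ∃ u, subAt m.t a.2 = some u ∧ IsConsistent u a.1.lhs then
    { m with am := m.am \ {a}, en := m.en ∪ {a} }
  else
    { m with am := m.am \ {a}, dis := m.dis ∪ {a} }

/-- The procedure `Update`, for a rewrite step at position `p`. -/
def update (m : Memory 𝓛 V S) (p : Position) : Memory 𝓛 V S :=
  let removed : Set (RuleAt 𝓛 V) := ⋃ c ∈ M.nodesBelow m.ct p, M.matchesNL c m.t
  let en₁ := m.en \ removed
  let dis₁ := m.dis \ removed
  let rem : Set (RuleAt 𝓛 V) :=
    {b | b ∈ en₁ ∪ dis₁ ∧ ∃ P ∈ varPartition b.1.lhs, 2 ≤ P.ncard ∧ ∃ q' ∈ P, b.2 ++ q' <+: p}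
  { m with
    en := en₁ \ rem
    dis := dis₁ \ rem
    am := (m.am \ removed) ∪ rem }

/-- The branch in which the selected action is a redex `a = (ℓ → r)@p` in `reds_L ∪ en`. -/
noncomputable def rewriteStep (m : Memory 𝓛 V S) (a : RuleAt 𝓛 V) : Memory 𝓛 V S :=
  { M.update m a.2 with
    redsL := m.redsL \ ⋃ c ∈ M.nodesBelow m.ct a.2, M.matchesL c m.t
    ct := M.prune a.2 m.ct
    t := contract m.t a.1 a.2 }

/-- The body of the while loop for the selected action. -/
noncomputable def exec (m : Memory 𝓛 V S) : Action 𝓛 V S → Memory 𝓛 V S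
  | .inl c => if c ∈ m.ct.buds then M.growStep m c else m
  | .inr a =>
      if a ∈ m.am then checkStep m a
      else if a ∈ m.redsL ∪ m.en then M.rewriteStep m a
      else m

/-- One iteration of the while loop. -/
def Iteration (sel : Strategy 𝓛 V S) (m m' : Memory 𝓛 V S) : Prop :=
  m.Guard ∧ ∃ a, sel.select m = some a ∧ m' = M.exec m a

/-- `NormalizeNonLinear(t₀, sel)` returns `t`: after finitely many iterations the guard of the
loop fails and the current term is `t`. -/
def NormalizeNonLinearReturns (sel : Strategy 𝓛 V S) (t₀ t : 𝓛.Term V) : Prop :=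
  ∃ m, Relation.ReflTransGen (M.Iteration sel) (M.start t₀) m ∧ ¬ m.Guard ∧ m.t = t

end NonLinearSetAutomaton

end

end SetAutomata

open SetAutomata

namespace SetAutomata
open scoped Classical
-- Terms: matching as agreement of head symbols plus consistency, and the effect of a rewrite step.
section Terms

variable {𝓛 : FirstOrder.Language.{u, v}} {V : Type w} {S : Type x}

/-! ### Subterms and replacement -/

/-! Let `W` be the prefix-closed set of positions inspected on the way to a configuration. The
obligation of each goal consists of exactly those non-variable subterms of its announced pattern
that sit on the frontier, the minimal positions outside `W` (`GoalInv`). So `W` and the announcement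
determine the goal. Moreover, wherever a state has an obligation it also has the fresh goals of all
left-hand sides (`StateInv`). A derivative preserves this with the inspected position added to `W`;
dependency classes and lifting only distribute the goals and re-address their positions.

Three facts follow. Announcements are sound: the head symbols of the pattern occur in the term
(`ConfInv.fits`). They are complete: a tree without buds announces every left-hand side wherever its
head symbols fit (`exists_announcedAt_of_oblPos`); groundness supplies a symbol at each inspected
position. And no match is announced both in a pruned and in a remaining node
(`ConfInv.prune_disjoint`), because sibling states have disjoint obligations on a common frontier
and an announced goal leaves the state.

The nodes that survive pruning at `p` inspect nothing at or below `p`, so a rewrite step there is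
invisible to them, and discarding the matches of the pruned nodes leaves exactly what the pruned
tree finds (`found_prune`). Consistency of a surviving match can change only if `p` lies at or below
a repeated variable (`consistentAt_congr`), and such matches go back to `am`. Hence `redsL` always
holds the linear matches found, `am`, `en` and `dis` together the non-linear ones, with `en`
consistent and `dis` inconsistent (`LoopInv`). On exit a redex would have been found, but only `dis`
can contain it, although it is consistent. -/

@[simp] theorem subAt_nil (t : 𝓛.Term V) : subAt t [] = some t := by
  cases t <;> rfl

@[simp] theorem subAt_var_cons (y : V) (i : ℕ) (p : Position) :
    subAt (.var y : 𝓛.Term V) (i :: p) = none := rfl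

theorem subAt_func_cons {n : ℕ} (f : 𝓛.Functions n) (ts : Fin n → 𝓛.Term V) (i : ℕ)
    (p : Position) :
    subAt (.func f ts) (i :: p) = if h : i < n then subAt (ts ⟨i, h⟩) p else none := rfl

theorem subAt_append (t : 𝓛.Term V) (p q : Position) :
    subAt t (p ++ q) = (subAt t p).bind fun u => subAt u q := by
  induction p generalizing t with
  | nil => simp
  | cons i p ih =>
    cases t with
    | var y => simp
    | func f ts =>
      simp only [List.cons_append, subAt_func_cons]
      split_ifs with h
      · exact ih _
      · rfl

theorem subAt_append_of_subAt {t u : 𝓛.Term V} {p : Position} (h : subAt t p = some u)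
    (q : Position) : subAt t (p ++ q) = subAt u q := by
  rw [subAt_append, h]; rfl

theorem headAt_append_of_subAt {t u : 𝓛.Term V} {p : Position} (h : subAt t p = some u)
    (q : Position) : headAt t (p ++ q) = headAt u q := by
  rw [headAt, subAt_append_of_subAt h]; rfl

@[simp] theorem headAt_nil (t : 𝓛.Term V) : headAt t [] = hd t := by simp [headAt]

theorem headAt_func_cons {n : ℕ} (f : 𝓛.Functions n) (ts : Fin n → 𝓛.Term V) (i : ℕ)
    (p : Position) :
    headAt (.func f ts) (i :: p) = if h : i < n then headAt (ts ⟨i, h⟩) p else none := by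
  simp only [headAt, subAt_func_cons]
  split_ifs <;> rfl

theorem isPattern_iff_hd {t : 𝓛.Term V} : IsPattern t ↔ ∃ f, hd t = some f := by
  cases t with
  | var y => simp [IsPattern, hd]
  | func f ts => simp [IsPattern, hd]

theorem headAt_eq_some_iff {t : 𝓛.Term V} {p : Position} {f : Symb 𝓛} :
    headAt t p = some f ↔ ∃ u, subAt t p = some u ∧ hd u = some f := by
  simp [headAt, Option.bind_eq_some_iff]

theorem subAt_singleton_eq_some_of_hd {t u : 𝓛.Term V} {f : Symb 𝓛} {i : ℕ} (h : hd t = some f)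
    (hu : subAt t [i] = some u) : i < f.1 := by
  cases t with
  | var y => simp at hu
  | func g ts =>
    simp only [hd, Option.some.injEq] at h
    subst h
    rw [subAt_func_cons] at hu
    split_ifs at hu with h
    exact h

theorem mem_dom_append_singleton {t : 𝓛.Term V} {p : Position} {f : Symb 𝓛} {i : ℕ}
    (h : headAt t p = some f) (hi : i < f.1) : p ++ [i] ∈ dom t := by
  obtain ⟨u, hu, hf⟩ := headAt_eq_some_iff.1 h
  cases u with
  | var y => simp [hd] at hf
  | func g ts =>
    simp only [hd, Option.some.injEq] at hf
    subst hf
    exact ⟨ts ⟨i, hi⟩, by simp [subAt_append_of_subAt hu, subAt_func_cons, hi]⟩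

/-- A position with a proper extension in the domain carries a function symbol whose arity
exceeds the next argument place. -/
theorem exists_headAt_of_mem_dom_append_cons {t : 𝓛.Term V} {p q : Position} {i : ℕ}
    (h : p ++ i :: q ∈ dom t) : ∃ f, headAt t p = some f ∧ i < f.1 := by
  obtain ⟨u, hu⟩ := h
  rw [subAt_append, Option.bind_eq_some_iff] at hu
  obtain ⟨w, hw, hu⟩ := hu
  cases w with
  | var y => simp at hu
  | func f ts =>
    rw [subAt_func_cons] at hu
    split_ifs at hu with h
    exact ⟨⟨_, f⟩, headAt_eq_some_iff.2 ⟨_, hw, rfl⟩, h⟩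

theorem mem_dom_of_headAt {t : 𝓛.Term V} {p : Position} {f : Symb 𝓛} (h : headAt t p = some f) :
    p ∈ dom t :=
  (headAt_eq_some_iff.1 h).imp fun _ h => h.1

theorem exists_headAt_of_prefix_ne {t : 𝓛.Term V} {p q : Position} (h : p <+: q) (hne : p ≠ q)
    (hq : q ∈ dom t) : ∃ f, headAt t p = some f := by
  obtain ⟨r, rfl⟩ := h
  cases r with
  | nil => simp at hne
  | cons i r => exact (exists_headAt_of_mem_dom_append_cons hq).imp fun _ h => h.1

theorem subAt_replaceAt_self {t u : 𝓛.Term V} {p : Position} (h : p ∈ dom t) :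
    subAt (replaceAt t p u) p = some u := by
  induction p generalizing t with
  | nil => cases t <;> simp [replaceAt]
  | cons i p ih =>
    obtain ⟨w, hw⟩ := h
    cases t with
    | var y => simp at hw
    | func f ts =>
      rw [subAt_func_cons] at hw
      split_ifs at hw with hi
      simp only [replaceAt, subAt_func_cons, hi, dite_true, if_true]
      exact ih ⟨w, hw⟩

theorem replaceAt_subAt {t u : 𝓛.Term V} {p : Position} (h : subAt t p = some u) :
    replaceAt t p u = t := by
  induction p generalizing t with
  | nil => cases t <;> simp_all [replaceAt]
  | cons i p ih =>
    cases t with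
    | var y => rfl
    | func f ts =>
      rw [subAt_func_cons] at h
      split_ifs at h with hi
      simp only [replaceAt]
      congr 1
      funext j
      split_ifs with hj
      · subst hj
        exact ih h
      · rfl

theorem headAt_replaceAt {t u : 𝓛.Term V} {p q : Position} (h : ¬ p <+: q) :
    headAt (replaceAt t p u) q = headAt t q := by
  induction p generalizing t q with
  | nil => simp at h
  | cons i p ih =>
    cases t with
    | var y => rfl
    | func f ts =>
      cases q with
      | nil => simp [replaceAt, hd]
      | cons j q =>
        simp only [replaceAt, headAt_func_cons]
        split_ifs with hj hi
        · subst hi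
          exact ih fun h' => h (by simpa using h')
        · rfl
        · rfl

theorem subAt_replaceAt {t u : 𝓛.Term V} {p q : Position} (h : ¬ p <+: q) (h' : ¬ q <+: p) :
    subAt (replaceAt t p u) q = subAt t q := by
  induction p generalizing t q with
  | nil => simp at h
  | cons i p ih =>
    cases t with
    | var y => rfl
    | func f ts =>
      cases q with
      | nil => simp at h'
      | cons j q =>
        simp only [replaceAt, subAt_func_cons]
        split_ifs with hj hi
        · subst hi
          exact ih (fun h'' => h (by simpa using h'')) (fun h'' => h' (by simpa using h''))
        · rfl
        · rfl

/-! ### Variables, groundness and substitution -/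

theorem mem_vars_func {n : ℕ} {f : 𝓛.Functions n} {ts : Fin n → 𝓛.Term V} {y : V} :
    y ∈ vars (.func f ts) ↔ ∃ i, y ∈ vars (ts i) := by
  simp only [vars, FirstOrder.Language.Term.varFinset, Finset.mem_biUnion, Finset.mem_univ,
    true_and]

theorem mem_vars_var {y z : V} : y ∈ vars (.var z : 𝓛.Term V) ↔ y = z := by
  simp [vars, FirstOrder.Language.Term.varFinset]

theorem mem_vars_iff {t : 𝓛.Term V} {y : V} : y ∈ vars t ↔ ∃ p, subAt t p = some (.var y) := by
  induction t with
  | var z =>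
    rw [mem_vars_var]
    constructor
    · rintro rfl
      exact ⟨[], by simp⟩
    · rintro ⟨_ | ⟨i, p⟩, h⟩
      · simpa using h.symm
      · simp at h
  | func f ts ih =>
    simp only [mem_vars_func, ih]
    constructor
    · rintro ⟨i, p, h⟩
      exact ⟨i :: p, by simpa [subAt_func_cons] using h⟩
    · rintro ⟨_ | ⟨i, p⟩, h⟩
      · simp at h
      · rw [subAt_func_cons] at h
        split_ifs at h with hi
        exact ⟨⟨i, hi⟩, p, h⟩

theorem isGround_iff {t : 𝓛.Term V} : IsGround t ↔ ∀ p y, subAt t p ≠ some (.var y) := by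
  simp only [IsGround, Finset.eq_empty_iff_forall_notMem, mem_vars_iff, not_exists]
  exact forall_comm

theorem IsGround.exists_headAt {t : 𝓛.Term V} (ht : IsGround t) {p : Position} (hp : p ∈ dom t) :
    ∃ f, headAt t p = some f := by
  obtain ⟨u, hu⟩ := hp
  cases u with
  | var y => exact (isGround_iff.1 ht p y hu).elim
  | func f ts => exact ⟨⟨_, f⟩, headAt_eq_some_iff.2 ⟨_, hu, rfl⟩⟩

theorem mem_vars_subst {t : 𝓛.Term V} {σ : V → 𝓛.Term V} {y : V} :
    y ∈ vars (t.subst σ) ↔ ∃ z ∈ vars t, y ∈ vars (σ z) := by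
  induction t with
  | var z => simp [FirstOrder.Language.Term.subst, mem_vars_var]
  | func f ts ih =>
    simp only [FirstOrder.Language.Term.subst, mem_vars_func, ih]
    grind

theorem subAt_subst {t u : 𝓛.Term V} {p : Position} (σ : V → 𝓛.Term V) (h : subAt t p = some u) :
    subAt (t.subst σ) p = some (u.subst σ) := by
  induction p generalizing t with
  | nil => simp_all
  | cons i p ih =>
    cases t with
    | var y => simp at h
    | func f ts =>
      rw [subAt_func_cons] at h
      split_ifs at h with hi
      simp only [FirstOrder.Language.Term.subst, subAt_func_cons, hi, dite_true]
      exact ih h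

/-- The head symbols of `ℓ` occur at the same positions of `t`. -/
def Fits (t ℓ : 𝓛.Term V) : Prop := ∀ r f, headAt ℓ r = some f → headAt t r = some f

theorem fits_subst (ℓ : 𝓛.Term V) (σ : V → 𝓛.Term V) : Fits (ℓ.subst σ) ℓ := by
  intro r f h
  obtain ⟨u, hu, hf⟩ := headAt_eq_some_iff.1 h
  refine headAt_eq_some_iff.2 ⟨_, subAt_subst σ hu, ?_⟩
  cases u with
  | var y => simp [hd] at hf
  | func g ts => exact hf

theorem eq_subst_of_fits {t ℓ : 𝓛.Term V} {σ : V → 𝓛.Term V} (h : Fits t ℓ)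
    (hσ : ∀ r y, subAt ℓ r = some (.var y) → subAt t r = some (σ y)) : t = ℓ.subst σ := by
  induction ℓ generalizing t with
  | var y => simpa using hσ [] y (by simp)
  | func f ts ih =>
    have hf := h [] ⟨_, f⟩ (by simp [hd])
    cases t with
    | var y => simp [hd] at hf
    | func g us =>
      simp only [headAt_nil, hd, Option.some.injEq] at hf
      cases hf
      simp only [FirstOrder.Language.Term.subst]
      congr 1
      funext i
      refine ih i (fun r f' hr => ?_) fun r y hr => ?_
      · simpa [headAt_func_cons] using h (i :: r) f' (by simpa [headAt_func_cons] using hr)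
      · simpa [subAt_func_cons] using hσ (i :: r) y (by simpa [subAt_func_cons] using hr)

theorem Fits.mem_dom {t ℓ : 𝓛.Term V} (h : Fits t ℓ) {r : Position} (hr : r ∈ dom ℓ) :
    r ∈ dom t := by
  rcases List.eq_nil_or_concat r with rfl | ⟨r, i, rfl⟩
  · exact ⟨t, by simp⟩
  · rw [List.concat_eq_append] at *
    obtain ⟨f, hf, hi⟩ := exists_headAt_of_mem_dom_append_cons hr
    exact mem_dom_append_singleton (h _ _ hf) hi

theorem isConsistent_iff {t ℓ : 𝓛.Term V} : IsConsistent t ℓ ↔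
    ∀ p q y, subAt ℓ p = some (.var y) → subAt ℓ q = some (.var y) → subAt t p = subAt t q := by
  constructor
  · intro h p q y hp hq
    exact h _ ⟨p, ⟨y, hp⟩, rfl⟩ p ⟨⟨y, hp⟩, rfl⟩ q ⟨⟨y, hq⟩, hq.trans hp.symm⟩
  · rintro h _ ⟨p, ⟨y, hp⟩, rfl⟩ q ⟨-, hq⟩ q' ⟨-, hq'⟩
    exact h q q' y (hq.trans hp) (hq'.trans hp)

theorem isConsistent_subst (ℓ : 𝓛.Term V) (σ : V → 𝓛.Term V) : IsConsistent (ℓ.subst σ) ℓ := by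
  rw [isConsistent_iff]
  intro p q y hp hq
  rw [subAt_subst σ hp, subAt_subst σ hq]

/-- Separates what the automaton sees, the head symbols, from what the procedure tests, the equality
of subterms at repeated variables. Given both, `σ y` is the common subterm at the occurrences of
`y`. -/
theorem matches_iff {t ℓ : 𝓛.Term V} : Matches t ℓ ↔ Fits t ℓ ∧ IsConsistent t ℓ := by
  constructor
  · rintro ⟨σ, rfl⟩
    exact ⟨fits_subst ℓ σ, isConsistent_subst ℓ σ⟩
  · rintro ⟨hf, hc⟩
    rw [isConsistent_iff] at hc
    have hex : ∀ y, ∃ u, ∀ r, subAt ℓ r = some (.var y) → subAt t r = some u := by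
      intro y
      by_cases h : ∃ r, subAt ℓ r = some (.var y)
      · obtain ⟨r, hr⟩ := h
        obtain ⟨u, hu⟩ := hf.mem_dom ⟨_, hr⟩
        exact ⟨u, fun q hq => (hc q r y hq hr).trans hu⟩
      -- A variable that does not occur in `ℓ` may be sent anywhere; `t` serves.
      · exact ⟨t, fun r hr => (h ⟨r, hr⟩).elim⟩
    choose σ hσ using hex
    exact ⟨σ, eq_subst_of_fits hf fun r y => hσ y r⟩

/-! ### Linear patterns -/

/-- Linearity compares values of `Set.ncard`, which measure size only for finite sets. -/
theorem edge_finite (t : 𝓛.Term V) : (edge t).Finite := by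
  induction t with
  | var y =>
    refine (Set.finite_singleton ([] : Position)).subset ?_
    rintro (_ | ⟨i, p⟩) ⟨z, hz⟩
    · rfl
    · simp at hz
  | func f ts ih =>
    refine (Set.finite_iUnion fun i => (ih i).image (List.cons (i : ℕ))).subset ?_
    rintro (_ | ⟨i, p⟩) ⟨z, hz⟩
    · simp at hz
    · rw [subAt_func_cons] at hz
      split_ifs at hz with hi
      exact Set.mem_iUnion.2 ⟨⟨i, hi⟩, p, ⟨z, hz⟩, rfl⟩

theorem varPartition_eq_image (ℓ : 𝓛.Term V) :
    varPartition ℓ = (fun p => {q | q ∈ edge ℓ ∧ subAt ℓ q = subAt ℓ p}) '' edge ℓ := by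
  ext P
  simp [varPartition, eq_comm]

theorem isLinear_or_isNonLinear (ℓ : 𝓛.Term V) : IsLinear ℓ ∨ IsNonLinear ℓ := by
  have := Set.ncard_image_le (f := fun p => {q | q ∈ edge ℓ ∧ subAt ℓ q = subAt ℓ p})
    (edge_finite ℓ)
  rw [← varPartition_eq_image] at this
  exact this.eq_or_lt

/-- Sending a variable position to its class maps the edge onto the partition. With equal finite
cardinalities this map is injective, so consistency compares each subterm only with itself. -/
theorem IsLinear.isConsistent {ℓ : 𝓛.Term V} (h : IsLinear ℓ) (t : 𝓛.Term V) :
    IsConsistent t ℓ := by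
  rw [IsLinear, varPartition_eq_image] at h
  have hinj := Set.injOn_of_ncard_image_eq h (edge_finite ℓ)
  rw [isConsistent_iff]
  intro p q y hp hq
  rw [hinj ⟨y, hp⟩ ⟨y, hq⟩ (by simp [hp, hq])]

/-! ### Rewriting -/

/-- `contract` is an epsilon choice, so exhibiting one reduct suffices. -/
theorem IsRedex.rewritesAt_contract {t : 𝓛.Term V} {ρ : Rule 𝓛 V} {p : Position}
    (h : IsRedex t ρ p) : RewritesAt ρ p t (contract t ρ p) := by
  obtain ⟨u, hu, σ, rfl⟩ := h
  exact Classical.epsilon_spec_aux _ _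
    ⟨replaceAt t p (ρ.rhs.subst σ), t, σ, ⟨_, hu⟩, (replaceAt_subAt hu).symm, rfl⟩

namespace RewritesAt

variable {t t' : 𝓛.Term V} {ρ : Rule 𝓛 V} {p : Position}

theorem headAt_eq (h : RewritesAt ρ p t t') {q : Position} (hq : ¬ p <+: q) :
    headAt t' q = headAt t q := by
  obtain ⟨u, σ, -, rfl, rfl⟩ := h
  rw [headAt_replaceAt hq, headAt_replaceAt hq]

theorem subAt_eq (h : RewritesAt ρ p t t') {q : Position} (hq : ¬ p <+: q) (hq' : ¬ q <+: p) :
    subAt t' q = subAt t q := by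
  obtain ⟨u, σ, -, rfl, rfl⟩ := h
  rw [subAt_replaceAt hq hq', subAt_replaceAt hq hq']

/-- A variable inside the contractum comes from some `σ z` with `z` in the right-hand side, hence in
the left-hand side, so it would already occur in `t`. Strictly above `p` there are function symbols,
and elsewhere the two terms agree. -/
theorem isGround (h : RewritesAt ρ p t t') (ht : IsGround t) : IsGround t' := by
  have h' := h
  obtain ⟨u, σ, hp, ht₁, ht₂⟩ := h
  rw [isGround_iff] at ht ⊢
  intro q y hq
  by_cases hpq : p <+: q
  · obtain ⟨r, rfl⟩ := hpq
    rw [ht₂, subAt_append_of_subAt (subAt_replaceAt_self hp)] at hq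
    obtain ⟨z, hz, hy⟩ := mem_vars_subst.1 (mem_vars_iff.2 ⟨r, hq⟩)
    obtain ⟨r', hr'⟩ := mem_vars_iff.1 (mem_vars_subst.2 ⟨z, ρ.vars_rhs_subset hz, hy⟩)
    refine ht (p ++ r') y ?_
    rw [ht₁, subAt_append_of_subAt (subAt_replaceAt_self hp), hr']
  · by_cases hqp : q <+: p
    · obtain ⟨f, hf⟩ := exists_headAt_of_prefix_ne hqp (by rintro rfl; simp at hpq) hp
      rw [← headAt_replaceAt hpq (u := ρ.rhs.subst σ), ← ht₂, headAt, hq] at hf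
      simp [hd] at hf
    · exact ht q y ((h'.subAt_eq hpq hqp).symm.trans hq)

end RewritesAt

end Terms

/-! ### Match goals: the frontier invariant, its preservation, and what becomes of announcements. -/

section Goals

variable {𝓛 : FirstOrder.Language.{u, v}} {V : Type w} {R : TRS 𝓛 V} {t : 𝓛.Term V}

/-! ### Membership in the sets of the construction -/

theorem TRS.isPattern_of_mem_lhss {ℓ : 𝓛.Term V} (h : ℓ ∈ R.lhss) : IsPattern ℓ := by
  obtain ⟨ρ, -, rfl⟩ := Finset.mem_image.1 h
  exact ρ.isPattern_lhs

theorem Obligation.mem_pos {mo : Obligation 𝓛 V} {x : Position} :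
    x ∈ Obligation.pos mo ↔ ∃ u, (u, x) ∈ mo := by
  simp [Obligation.pos]

theorem mem_patternArgs {ℓ u : 𝓛.Term V} {f : Symb 𝓛} {i : ℕ} :
    (u, i) ∈ patternArgs ℓ f ↔ i < f.1 ∧ subAt ℓ [i] = some u ∧ IsPattern u := by
  simp only [patternArgs, Finset.mem_biUnion, Finset.mem_range, Finset.mem_image,
    Finset.mem_filter, Option.mem_toFinset, Option.mem_def, Prod.mk.injEq]
  grind

theorem mem_reduce {mo : Obligation 𝓛 V} {f : Symb 𝓛} {u : 𝓛.Term V} {x y : Position} :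
    (u, x) ∈ reduce mo f y ↔ ((u, x) ∈ mo ∧ x ≠ y) ∨
      ∃ v i, (v, y) ∈ mo ∧ i < f.1 ∧ subAt v [i] = some u ∧ IsPattern u ∧ x = y ++ [i] := by
  simp only [reduce, Finset.mem_union, Finset.mem_filter, Finset.mem_biUnion, Finset.mem_image,
    Prod.exists, mem_patternArgs, Prod.mk.injEq]
  refine or_congr Iff.rfl ⟨?_, ?_⟩
  · rintro ⟨v, _, ⟨hv, rfl⟩, _, i, ⟨hi, hu, hp⟩, rfl, rfl⟩
    exact ⟨v, i, hv, hi, hu, hp, rfl⟩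
  · rintro ⟨v, i, hv, hi, hu, hp, rfl⟩
    exact ⟨v, y, ⟨hv, rfl⟩, u, i, ⟨hi, hu, hp⟩, rfl, rfl⟩

theorem mem_deriv {s : GoalSet 𝓛 V} {y : Position} {f : Symb 𝓛} {g : Goal 𝓛 V} :
    g ∈ deriv R s y f ↔
      (∃ h ∈ s, (∃ v, (v, y) ∈ h.1 ∧ hd v = some f) ∧ reduce h.1 f y ≠ ∅ ∧
        g = (reduce h.1 f y, h.2)) ∨
      (g ∈ s ∧ y ∉ Obligation.pos g.1) ∨
      ∃ ℓ ∈ R.lhss, ∃ i < f.1, g = freshGoal ℓ (y ++ [i]) := by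
  simp only [deriv, Finset.mem_union, Finset.mem_filter, Finset.mem_image, Prod.exists,
    Finset.mem_product, Finset.mem_range]
  grind

theorem mem_liftObligation {q x : Position} {mo : Obligation 𝓛 V} {u : 𝓛.Term V} :
    (u, x) ∈ liftObligation q mo ↔ (u, q ++ x) ∈ mo := by
  simp only [liftObligation, Finset.mem_image, Finset.mem_filter, Prod.exists, Prod.mk.injEq]
  constructor
  · rintro ⟨_, _, ⟨h, z, rfl⟩, rfl, rfl⟩
    simpa using h
  · intro h
    exact ⟨u, q ++ x, ⟨h, by simp⟩, rfl, by simp⟩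

theorem mem_lift {K : GoalSet 𝓛 V} {g : Goal 𝓛 V} :
    g ∈ lift K ↔ ∃ h ∈ K, h.2.2 = gcp K ++ g.2.2 ∧ g.1 = liftObligation (gcp K) h.1 ∧
      g.2.1 = h.2.1 := by
  simp only [lift, Finset.mem_image, Finset.mem_filter]
  constructor
  · rintro ⟨h, ⟨hK, z, hz⟩, rfl⟩
    exact ⟨h, hK, by simp [← hz], rfl, rfl⟩
  · rintro ⟨h, hK, h₁, h₂, h₃⟩
    refine ⟨h, ⟨hK, h₁ ▸ List.prefix_append _ _⟩, ?_⟩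
    obtain ⟨mo, ℓ, p⟩ := g
    simp_all

/-! ### Frontiers -/

/-- `x` is a minimal position outside `W`. -/
def Frontier (W : Set Position) (x : Position) : Prop :=
  x ∉ W ∧ ∀ x', x' <+: x → x' ≠ x → x' ∈ W

/-- `W` contains all prefixes of its elements. -/
def PrefixClosed (W : Set Position) : Prop := ∀ x ∈ W, ∀ x', x' <+: x → x' ∈ W

theorem Frontier.eq_of_prefix {W : Set Position} {x y : Position} (hx : Frontier W x)
    (hy : Frontier W y) (h : x <+: y) : x = y := by
  by_contra hne
  exact hx.1 (hy.2 x h hne)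

theorem Frontier.eq_of_prefix_of_prefix {W : Set Position} {x y z : Position} (hx : Frontier W x)
    (hy : Frontier W y) (h : x <+: z) (h' : y <+: z) : x = y := by
  rcases List.prefix_or_prefix_of_prefix h h' with h | h
  · exact hx.eq_of_prefix hy h
  · exact (hy.eq_of_prefix hx h).symm

theorem PrefixClosed.insert {W : Set Position} {y : Position} (hW : PrefixClosed W)
    (hy : Frontier W y) : PrefixClosed (insert y W) := by
  rintro x (rfl | hx) x' h
  · by_cases hne : x' = x
    · exact .inl hne
    · exact .inr (hy.2 x' h hne)
  · exact .inr (hW x hx x' h)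

theorem PrefixClosed.notMem_append {W : Set Position} {y : Position} (hW : PrefixClosed W)
    (hy : y ∉ W) (z : Position) : y ++ z ∉ W :=
  fun h => hy (hW _ h _ (List.prefix_append _ _))

theorem append_cons_notMem_insert {W : Set Position} {y : Position} (hW : PrefixClosed W)
    (hy : y ∉ W) (i : ℕ) (z : Position) : y ++ i :: z ∉ insert y W := by
  rintro (h | h)
  · simp at h
  · exact hW.notMem_append hy _ h

/-- Inspecting a frontier position replaces it by its immediate successors. Every natural number
counts as an argument place here; the domain of the term is tracked separately by `GoalInv.mem_dom`.
-/
theorem frontier_insert {W : Set Position} {x y : Position} (hW : PrefixClosed W)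
    (hy : Frontier W y) :
    Frontier (insert y W) x ↔ (Frontier W x ∧ x ≠ y) ∨ ∃ i, x = y ++ [i] := by
  constructor
  · rintro ⟨h₁, h₂⟩
    rw [Set.mem_insert_iff, not_or] at h₁
    by_cases h : y <+: x
    · obtain ⟨z, rfl⟩ := h
      rcases z with _ | ⟨i, z⟩
      · simp at h₁
      · refine .inr ⟨i, ?_⟩
        by_contra hne
        exact append_cons_notMem_insert hW hy.1 i [] (h₂ (y ++ [i]) ⟨z, by simp⟩ (Ne.symm hne))
    · refine .inl ⟨⟨h₁.2, fun x' hx hne => ?_⟩, h₁.1⟩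
      rcases h₂ x' hx hne with rfl | h'
      · exact (h hx).elim
      · exact h'
  · rintro (⟨h, hne⟩ | ⟨i, rfl⟩)
    · exact ⟨by simp [hne, h.1], fun x' hx hx' => .inr (h.2 x' hx hx')⟩
    · refine ⟨append_cons_notMem_insert hW hy.1 i [], fun x' hx hne => ?_⟩
      rcases List.prefix_concat_iff.1 hx with h | h
      · exact (hne (by simpa using h)).elim
      · exact hW.insert hy _ (.inl rfl) _ h

/-- Every position outside `W` extends a minimal one. -/
theorem exists_frontier_prefix {W : Set Position} {x : Position} (hx : x ∉ W) :
    ∃ x', x' <+: x ∧ Frontier W x' := by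
  induction h : x.length using Nat.strong_induction_on generalizing x with
  | _ n ih =>
    subst h
    by_cases hf : Frontier W x
    · exact ⟨x, List.prefix_rfl, hf⟩
    · simp only [Frontier, hx, not_false_eq_true, true_and, not_forall] at hf
      obtain ⟨z, hz, hne, hzW⟩ := hf
      obtain ⟨x', h, h'⟩ := ih z.length
        (lt_of_le_of_ne hz.length_le fun h => hne (hz.eq_of_length h)) hzW rfl
      exact ⟨x', h.trans hz, h'⟩

/-! ### The invariant of match goals -/

/-- The match goal `g`, read with all its positions below `q`, is what remains of its announced
pattern after the positions in `W` of the term `t` have been inspected. -/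
structure GoalInv (R : TRS 𝓛 V) (t : 𝓛.Term V) (W : Set Position) (q : Position)
    (g : Goal 𝓛 V) : Prop where
  mem : g.2.1 ∈ R.lhss
  obl : ∀ u x, (u, x) ∈ g.1 ↔
    Frontier W (q ++ x) ∧ IsPattern u ∧ ∃ r, x = g.2.2 ++ r ∧ subAt g.2.1 r = some u
  nonempty : g.1.Nonempty
  agree : ∀ r f, headAt g.2.1 r = some f → q ++ (g.2.2 ++ r) ∈ W →
    headAt t (q ++ (g.2.2 ++ r)) = some f
  mem_dom : ∀ u x, (u, x) ∈ g.1 → q ++ x ∈ dom t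

/-- The invariant of the states of the set automaton. -/
structure StateInv (R : TRS 𝓛 V) (t : 𝓛.Term V) (W : Set Position) (q : Position)
    (s : GoalSet 𝓛 V) : Prop where
  closed : PrefixClosed W
  goal : ∀ g ∈ s, GoalInv R t W q g
  fresh : ∀ g ∈ s, ∀ u x, (u, x) ∈ g.1 → ∀ ℓ ∈ R.lhss, freshGoal ℓ x ∈ s

variable {W : Set Position} {q : Position}

theorem GoalInv.frontier {g : Goal 𝓛 V} (h : GoalInv R t W q g) {u : 𝓛.Term V} {x : Position}
    (hx : (u, x) ∈ g.1) : Frontier W (q ++ x) := ((h.obl u x).1 hx).1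

theorem GoalInv.prefix {g : Goal 𝓛 V} (h : GoalInv R t W q g) {u : 𝓛.Term V} {x : Position}
    (hx : (u, x) ∈ g.1) : g.2.2 <+: x := by
  obtain ⟨-, -, r, rfl, -⟩ := (h.obl u x).1 hx
  exact List.prefix_append _ _

/-- `obl` describes the obligation through the announcement, `W` and `q` alone. The arguments that
an announcement is not made twice rest on this. -/
theorem GoalInv.ext {g h : Goal 𝓛 V} (hg : GoalInv R t W q g) (hh : GoalInv R t W q h)
    (heq : g.2 = h.2) : g = h := by
  refine Prod.ext (Finset.ext fun ⟨u, x⟩ => ?_) heq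
  rw [hg.obl, hh.obl, heq]

theorem GoalInv.unique {g : Goal 𝓛 V} (h : GoalInv R t W q g) {u v : 𝓛.Term V} {x : Position}
    (hu : (u, x) ∈ g.1) (hv : (v, x) ∈ g.1) : u = v := by
  obtain ⟨-, -, r, hr, hu⟩ := (h.obl u x).1 hu
  obtain ⟨-, -, r', hr', hv⟩ := (h.obl v x).1 hv
  obtain rfl : r = r' := by simpa using hr.symm.trans hr'
  simpa using hu.symm.trans hv

/-- Frontier positions are pairwise incomparable, so the root of `ℓ` is its only frontier position;
nothing of `ℓ` has been inspected, since `W` is prefix-closed. -/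
theorem GoalInv.freshGoal {W : Set Position} {ℓ : 𝓛.Term V} {x : Position} (hW : PrefixClosed W)
    (hx : Frontier W (q ++ x)) (hℓ : ℓ ∈ R.lhss) (hd : q ++ x ∈ dom t) :
    GoalInv R t W q (freshGoal ℓ x) where
  mem := hℓ
  obl u z := by
    simp only [SetAutomata.freshGoal, Finset.mem_singleton, Prod.mk.injEq]
    constructor
    · rintro ⟨rfl, rfl⟩
      exact ⟨hx, R.isPattern_of_mem_lhss hℓ, [], by simp⟩
    · rintro ⟨hz, -, r, rfl, hr⟩
      have := hx.eq_of_prefix hz (by simp)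
      obtain rfl : r = [] := by simpa using this
      simpa [eq_comm] using hr
  nonempty := by simp [SetAutomata.freshGoal]
  agree r f hr hW' := by
    rw [← List.append_assoc] at hW'
    exact (hW.notMem_append hx.1 r hW').elim
  mem_dom u z hz := by
    simp only [SetAutomata.freshGoal, Finset.mem_singleton, Prod.mk.injEq] at hz
    rwa [hz.2]

/-! ### Derivatives -/

section Deriv

variable {s : GoalSet 𝓛 V} {y : Position} {f : Symb 𝓛}

/-- The frontier trades `y` for its successors just as `reduce` trades the pattern at `y` for its
non-variable arguments. The symbol read is the head of that pattern, which extends `agree` to `y`.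
-/
theorem GoalInv.reduce {g : Goal 𝓛 V} (hW : PrefixClosed W) (h : GoalInv R t W q g)
    (hf : headAt t (q ++ y) = some f) {v : 𝓛.Term V} (hv : (v, y) ∈ g.1) (hvf : hd v = some f)
    (hne : reduce g.1 f y ≠ ∅) :
    GoalInv R t (insert (q ++ y) W) q (reduce g.1 f y, g.2) := by
  have hy := h.frontier hv
  obtain ⟨-, hvp, r₀, hr₀, hvs⟩ := (h.obl v y).1 hv
  refine ⟨h.mem, fun u x => ?_, Finset.nonempty_iff_ne_empty.2 hne, fun r f' hr hm => ?_,
    fun u x hx => ?_⟩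
  · simp only [mem_reduce]
    rw [frontier_insert hW hy]
    constructor
    · rintro (⟨hx, hne⟩ | ⟨v', i, hv', hi, hu, hup, rfl⟩)
      · obtain ⟨h₁, h₂⟩ := (h.obl u x).1 hx
        exact ⟨.inl ⟨h₁, by simpa using hne⟩, h₂⟩
      · obtain rfl := h.unique hv hv'
        refine ⟨.inr ⟨i, by simp⟩, hup, r₀ ++ [i], by simp [hr₀], ?_⟩
        rw [subAt_append_of_subAt hvs, hu]
    · rintro ⟨⟨h₁, hne⟩ | ⟨i, hi⟩, h₂⟩
      · exact .inl ⟨(h.obl u x).2 ⟨h₁, h₂⟩, fun h => hne (by rw [h])⟩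
      · obtain rfl : x = y ++ [i] := by simpa using hi
        obtain ⟨hup, r, hr, hu⟩ := h₂
        obtain rfl : r = r₀ ++ [i] := by
          rw [hr₀] at hr
          simpa using hr.symm
        rw [subAt_append_of_subAt hvs] at hu
        exact .inr ⟨v, i, hv, subAt_singleton_eq_some_of_hd hvf hu, hu, hup, rfl⟩
  · rcases hm with hm | hm
    · obtain rfl : r = r₀ := by
        have : g.2.2 ++ r = y := by simpa using hm
        rw [hr₀] at this
        simpa using this
      have : headAt g.2.1 r = some f := headAt_eq_some_iff.2 ⟨v, hvs, hvf⟩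
      rw [hm, hf, ← hr, this]
    · exact h.agree r f' hr hm
  · rcases mem_reduce.1 hx with ⟨hx, -⟩ | ⟨v', i, hv', hi, hu, hup, rfl⟩
    · exact h.mem_dom u x hx
    · rw [← List.append_assoc]
      exact mem_dom_append_singleton hf hi

/-- A goal without obligation at `y` has no non-variable part of its pattern at `y` or directly
below it, so moving the frontier past `y` does not concern it. -/
theorem GoalInv.unaffected {g : Goal 𝓛 V} (hW : PrefixClosed W) (h : GoalInv R t W q g)
    (hy : Frontier W (q ++ y)) (hyg : y ∉ Obligation.pos g.1) :
    GoalInv R t (insert (q ++ y) W) q g := by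
  have hyg' : ∀ u, (u, y) ∉ g.1 := fun u hu => hyg (Obligation.mem_pos.2 ⟨u, hu⟩)
  refine ⟨h.mem, fun u x => ?_, h.nonempty, fun r f' hr hm => ?_, h.mem_dom⟩
  · rw [h.obl, frontier_insert hW hy]
    refine ⟨fun ⟨h₁, h₂⟩ => ⟨.inl ⟨h₁, ?_⟩, h₂⟩, fun ⟨h₁, h₂⟩ => ⟨?_, h₂⟩⟩
    · intro hxy
      obtain rfl : x = y := by simpa using hxy
      exact hyg' u ((h.obl u x).2 ⟨h₁, h₂⟩)
    · rcases h₁ with h₁ | ⟨i, hi⟩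
      · exact h₁.1
      exfalso
      obtain rfl : x = y ++ [i] := by simpa using hi
      obtain ⟨hup, r, hr, hu⟩ := h₂
      rcases List.eq_nil_or_concat r with rfl | ⟨r, j, rfl⟩
      -- The announcement position is `y ++ [i]`. Some obligation position extends it, so `q ++ y`
      -- lies strictly above a frontier position and would be in `W`.
      · obtain ⟨⟨u₀, x₀⟩, h₀⟩ := h.nonempty
        have h₁ := h.prefix h₀
        rw [List.append_nil] at hr
        rw [← hr] at h₁
        obtain ⟨z, rfl⟩ := h₁
        refine hy.1 ((h.frontier h₀).2 _ ⟨i :: z, by simp⟩ (by simp))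
      -- The pattern has a function symbol at `y`, which would make `y` an obligation position.
      · rw [List.concat_eq_append, ← List.append_assoc] at hr
        obtain ⟨rfl, h₁⟩ := List.append_inj' hr rfl
        rw [List.concat_eq_append] at hu
        obtain ⟨f', hf', -⟩ := exists_headAt_of_mem_dom_append_cons ⟨u, hu⟩
        obtain ⟨w, hw, hwf⟩ := headAt_eq_some_iff.1 hf'
        exact hyg' w ((h.obl w _).2 ⟨hy, isPattern_iff_hd.2 ⟨_, hwf⟩, r, rfl, hw⟩)
  · rcases hm with hm | hm
    · obtain ⟨w, hw, hwf⟩ := headAt_eq_some_iff.1 hr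
      obtain rfl : g.2.2 ++ r = y := by simpa using hm
      exact (hyg' w ((h.obl w _).2 ⟨hy, isPattern_iff_hd.2 ⟨_, hwf⟩, r, rfl, hw⟩)).elim
    · exact h.agree r f' hr hm

theorem StateInv.freshGoal_mem_deriv (hs : StateInv R t W q s) {g : Goal 𝓛 V} (hg : g ∈ s)
    {u ℓ : 𝓛.Term V} {x : Position} (hx : (u, x) ∈ g.1) (hxy : x ≠ y) (hℓ : ℓ ∈ R.lhss) :
    freshGoal ℓ x ∈ deriv R s y f := by
  refine mem_deriv.2 (.inr (.inl ⟨hs.fresh g hg u x hx ℓ hℓ, ?_⟩))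
  simpa [Obligation.mem_pos, freshGoal] using Ne.symm hxy

theorem StateInv.deriv (hs : StateInv R t W q s) (hy : Frontier W (q ++ y))
    (hf : headAt t (q ++ y) = some f) :
    StateInv R t (insert (q ++ y) W) q (deriv R s y f) := by
  refine ⟨hs.closed.insert hy, fun g hg => ?_, fun g hg u x hx ℓ hℓ => ?_⟩
  · rcases mem_deriv.1 hg with ⟨h, hh, ⟨v, hv, hvf⟩, hne, rfl⟩ | ⟨hg, hyg⟩ | ⟨ℓ, hℓ, i, hi, rfl⟩
    · exact (hs.goal h hh).reduce hs.closed hf hv hvf hne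
    · exact (hs.goal g hg).unaffected hs.closed hy hyg
    · refine .freshGoal (hs.closed.insert hy) ?_ hℓ ?_
      · exact (frontier_insert hs.closed hy).2 (.inr ⟨i, by simp⟩)
      · rw [← List.append_assoc]
        exact mem_dom_append_singleton hf hi
  · rcases mem_deriv.1 hg with ⟨h, hh, -, -, rfl⟩ | ⟨hg, hyg⟩ | ⟨ℓ', hℓ', i, hi, rfl⟩
    · rcases mem_reduce.1 hx with ⟨hx, hne⟩ | ⟨v', i, hv', hi, hu, hup, rfl⟩
      · exact hs.freshGoal_mem_deriv hh hx hne hℓ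
      · exact mem_deriv.2 (.inr (.inr ⟨ℓ, hℓ, i, hi, rfl⟩))
    · refine hs.freshGoal_mem_deriv hg hx ?_ hℓ
      rintro rfl
      exact hyg (Obligation.mem_pos.2 ⟨u, hx⟩)
    · simp only [SetAutomata.freshGoal, Finset.mem_singleton, Prod.mk.injEq] at hx
      exact mem_deriv.2 (.inr (.inr ⟨ℓ, hℓ, i, hi, by rw [hx.2]⟩))

end Deriv

/-! ### Dependency classes -/

/-- Direct dependency among the goals of `s`. -/
def DepIn (s : GoalSet 𝓛 V) (g h : Goal 𝓛 V) : Prop := g ∈ s ∧ h ∈ s ∧ DirectDep g h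

theorem DepIn.symm {s : GoalSet 𝓛 V} {g h : Goal 𝓛 V} (H : DepIn s g h) : DepIn s h g :=
  ⟨H.2.1, H.1, by rw [DirectDep, Finset.inter_comm]; exact H.2.2⟩

theorem directDep_of_mem {g h : Goal 𝓛 V} {u v : 𝓛.Term V} {x : Position} (hg : (u, x) ∈ g.1)
    (hh : (v, x) ∈ h.1) : DirectDep g h :=
  ⟨x, Finset.mem_inter.2 ⟨Obligation.mem_pos.2 ⟨u, hg⟩, Obligation.mem_pos.2 ⟨v, hh⟩⟩⟩

theorem mem_depClass {s : GoalSet 𝓛 V} {g h : Goal 𝓛 V} :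
    h ∈ depClass s g ↔ h ∈ s ∧ Relation.ReflTransGen (DepIn s) g h := by
  simp only [depClass, Finset.mem_filter]
  rfl

theorem depIn_reflTransGen_symm {s : GoalSet 𝓛 V} {g h : Goal 𝓛 V}
    (H : Relation.ReflTransGen (DepIn s) g h) : Relation.ReflTransGen (DepIn s) h g := by
  induction H with
  | refl => exact .refl
  | tail _ h ih => exact .head h.symm ih

theorem depClass_eq_of_mem {s : GoalSet 𝓛 V} {g h : Goal 𝓛 V} (H : h ∈ depClass s g) :
    depClass s h = depClass s g := by
  have H := (mem_depClass.1 H).2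
  ext k
  simp only [mem_depClass]
  exact ⟨fun ⟨h₁, h₂⟩ => ⟨h₁, H.trans h₂⟩,
    fun ⟨h₁, h₂⟩ => ⟨h₁, (depIn_reflTransGen_symm H).trans h₂⟩⟩

theorem depClasses_eq {s K K' : GoalSet 𝓛 V} (hK : K ∈ depClasses s) (hK' : K' ∈ depClasses s)
    {g h : Goal 𝓛 V} (hg : g ∈ K) (hh : h ∈ K') {u v : 𝓛.Term V} {x : Position}
    (hu : (u, x) ∈ g.1) (hv : (v, x) ∈ h.1) : K = K' := by
  obtain ⟨k, -, rfl⟩ := Finset.mem_image.1 hK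
  obtain ⟨k', -, rfl⟩ := Finset.mem_image.1 hK'
  rw [← depClass_eq_of_mem hg, ← depClass_eq_of_mem hh]
  have hg' := (mem_depClass.1 hg).1
  have hh' := (mem_depClass.1 hh).1
  exact (depClass_eq_of_mem
    (mem_depClass.2 ⟨hh', .single ⟨hg', hh', directDep_of_mem hu hv⟩⟩)).symm

theorem subset_of_mem_depClasses {s K : GoalSet 𝓛 V} (hK : K ∈ depClasses s) : K ⊆ s := by
  obtain ⟨k, -, rfl⟩ := Finset.mem_image.1 hK
  exact fun g hg => (mem_depClass.1 hg).1

theorem exists_mem_depClasses {s : GoalSet 𝓛 V} {g : Goal 𝓛 V} (hg : g ∈ s) :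
    ∃ K ∈ depClasses s, g ∈ K :=
  ⟨_, Finset.mem_image_of_mem _ hg, mem_depClass.2 ⟨hg, .refl⟩⟩

/-- Goals that share an obligation position are dependent, so the fresh goals at `x` lie in the
class of every goal with an obligation at `x`. -/
theorem StateInv.depClass {s K : GoalSet 𝓛 V} (hs : StateInv R t W q s)
    (hK : K ∈ depClasses s) : StateInv R t W q K where
  closed := hs.closed
  goal g hg := hs.goal g (subset_of_mem_depClasses hK hg)
  fresh g hg u x hx ℓ hℓ := by
    obtain ⟨K', hK', h⟩ :=
      exists_mem_depClasses (hs.fresh g (subset_of_mem_depClasses hK hg) u x hx ℓ hℓ)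
    rwa [depClasses_eq hK hK' hg h hx (Finset.mem_singleton_self _)]

/-- The announcement positions in a dependency class have a least element. -/
theorem StateInv.exists_least {s K : GoalSet 𝓛 V} (hs : StateInv R t W q s)
    (hK : K ∈ depClasses s) : ∃ g ∈ K, ∀ h ∈ K, g.2.2 <+: h.2.2 := by
  obtain ⟨k, hk, rfl⟩ := Finset.mem_image.1 hK
  obtain ⟨g, hg, hmin⟩ := Finset.exists_min_image (SetAutomata.depClass s k)
    (fun g => g.2.2.length) ⟨k, mem_depClass.2 ⟨hk, .refl⟩⟩
  refine ⟨g, hg, fun h hh => ?_⟩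
  have key : Relation.ReflTransGen (DepIn s) g h :=
    (depIn_reflTransGen_symm (mem_depClass.1 hg).2).trans (mem_depClass.1 hh).2
  clear hh
  induction key with
  | refl => exact List.prefix_rfl
  | @tail a b hga hab ih =>
    obtain ⟨ha, hb, x, hx⟩ := hab
    have hx := Finset.mem_inter.1 hx
    obtain ⟨u, hu⟩ := Obligation.mem_pos.1 hx.1
    obtain ⟨v, hv⟩ := Obligation.mem_pos.1 hx.2
    -- `g.2.2` and `b.2.2` are both prefixes of the shared position `x`, hence comparable, and
    -- `g.2.2` has minimal length.
    have h₁ := ih.trans ((hs.goal a ha).prefix hu)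
    have h₂ := (hs.goal b hb).prefix hv
    have hlen := hmin b (mem_depClass.2 ⟨hb, (mem_depClass.1 hg).2.trans
      (hga.tail ⟨ha, hb, directDep_of_mem hu hv⟩)⟩)
    exact List.prefix_of_prefix_length_le h₁ h₂ hlen

/-- Since the greatest common prefix is attained by a goal, lifting turns that goal into a root
goal, from which the next label can be taken. -/
theorem gcp_eq {K : GoalSet 𝓛 V} {g : Goal 𝓛 V} (hg : g ∈ K) (h : ∀ h ∈ K, g.2.2 <+: h.2.2) :
    gcp K = g.2.2 := by
  have : IsGcp K (gcp K) := Classical.epsilon_spec ⟨g.2.2, h, fun q' hq' => hq' g hg⟩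
  have h₁ := this.1 g hg
  exact h₁.eq_of_length_le (this.2 _ h).length_le

theorem gcp_prefix {K : GoalSet 𝓛 V} (hK : ∃ g ∈ K, ∀ h ∈ K, g.2.2 <+: h.2.2) {h : Goal 𝓛 V}
    (hh : h ∈ K) : gcp K <+: h.2.2 := by
  obtain ⟨g, hg, hmin⟩ := hK
  rw [gcp_eq hg hmin]
  exact hmin h hh

/-! ### Lifting -/

/-- `W` consists of absolute positions, and only their splitting into base and offset changes. -/
theorem GoalInv.lift {g : Goal 𝓛 V} {k p : Position} (h : GoalInv R t W q g)
    (hp : g.2.2 = k ++ p) : GoalInv R t W (q ++ k) (liftObligation k g.1, (g.2.1, p)) where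
  mem := h.mem
  obl u x := by simp [mem_liftObligation, h.obl, hp]
  nonempty := by
    obtain ⟨⟨u, x⟩, hx⟩ := h.nonempty
    obtain ⟨z, rfl⟩ := (hp ▸ List.prefix_append k p : k <+: g.2.2).trans (h.prefix hx)
    exact ⟨(u, z), mem_liftObligation.2 hx⟩
  agree r f := by simpa [hp] using h.agree r f
  mem_dom u x hx := by simpa using h.mem_dom u _ (mem_liftObligation.1 hx)

theorem StateInv.lift {K : GoalSet 𝓛 V} (hK : StateInv R t W q K) :
    StateInv R t W (q ++ gcp K) (lift K) where
  closed := hK.closed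
  goal g hg := by
    obtain ⟨h, hh, h₁, h₂, h₃⟩ := mem_lift.1 hg
    have := (hK.goal h hh).lift h₁
    rwa [← h₂, ← h₃] at this
  fresh g hg u x hx ℓ hℓ := by
    obtain ⟨h, hh, h₁, h₂, h₃⟩ := mem_lift.1 hg
    rw [h₂, mem_liftObligation] at hx
    refine mem_lift.2 ⟨_, hK.fresh h hh u _ hx ℓ hℓ, rfl, ?_, rfl⟩
    ext ⟨v, z⟩
    simp [mem_liftObligation, freshGoal]

/-- The absolute obligation positions of a state at position `q`. -/
def oblPos (q : Position) (s : GoalSet 𝓛 V) : Set Position :=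
  {z | ∃ g ∈ s, ∃ u x, (u, x) ∈ g.1 ∧ z = q ++ x}

/-- The absolute announcements of a state at position `q`. -/
def announcements (q : Position) (s : GoalSet 𝓛 V) : Set (𝓛.Term V × Position) :=
  {a | ∃ g ∈ s, a = (g.2.1, q ++ g.2.2)}

theorem announcements_lift {K : GoalSet 𝓛 V} (hK : ∃ g ∈ K, ∀ h ∈ K, g.2.2 <+: h.2.2) :
    announcements (q ++ gcp K) (lift K) = announcements q K := by
  ext a
  constructor
  · rintro ⟨g, hg, rfl⟩
    obtain ⟨h, hh, h₁, h₂, h₃⟩ := mem_lift.1 hg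
    exact ⟨h, hh, by simp [h₁, h₃]⟩
  · rintro ⟨h, hh, rfl⟩
    obtain ⟨z, hz⟩ := gcp_prefix hK hh
    exact ⟨(liftObligation (gcp K) h.1, (h.2.1, z)), mem_lift.2 ⟨h, hh, hz.symm, rfl, rfl⟩,
      by simp [← hz]⟩

theorem oblPos_lift {K : GoalSet 𝓛 V} (hK : ∃ g ∈ K, ∀ h ∈ K, g.2.2 <+: h.2.2)
    (hinv : StateInv R t W q K) : oblPos (q ++ gcp K) (lift K) = oblPos q K := by
  ext a
  constructor
  · rintro ⟨g, hg, u, x, hx, rfl⟩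
    obtain ⟨h, hh, h₁, h₂, h₃⟩ := mem_lift.1 hg
    rw [h₂, mem_liftObligation] at hx
    exact ⟨h, hh, u, _, hx, by simp⟩
  · rintro ⟨h, hh, u, x, hx, rfl⟩
    obtain ⟨z, hz⟩ := gcp_prefix hK hh
    obtain ⟨z', rfl⟩ := (gcp_prefix hK hh).trans ((hinv.goal h hh).prefix hx)
    exact ⟨(liftObligation (gcp K) h.1, (h.2.1, z)), mem_lift.2 ⟨h, hh, hz.symm, rfl, rfl⟩,
      u, z', mem_liftObligation.2 hx, by simp⟩

theorem StateInv.frontier {s : GoalSet 𝓛 V} (hs : StateInv R t W q s) {x : Position}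
    (hx : x ∈ oblPos q s) : Frontier W x := by
  obtain ⟨g, hg, u, z, hz, rfl⟩ := hx
  exact (hs.goal g hg).frontier hz

theorem StateInv.mem_dom {s : GoalSet 𝓛 V} (hs : StateInv R t W q s) {x : Position}
    (hx : x ∈ oblPos q s) : x ∈ dom t := by
  obtain ⟨g, hg, u, z, hz, rfl⟩ := hx
  exact (hs.goal g hg).mem_dom u z hz

theorem StateInv.exists_oblPos {s : GoalSet 𝓛 V} (hs : StateInv R t W q s)
    {a : 𝓛.Term V × Position} (ha : a ∈ announcements q s) : ∃ x ∈ oblPos q s, a.2 <+: x := by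
  obtain ⟨g, hg, rfl⟩ := ha
  obtain ⟨⟨u, x⟩, hx⟩ := (hs.goal g hg).nonempty
  exact ⟨_, ⟨g, hg, u, x, hx, rfl⟩, by simpa using (hs.goal g hg).prefix hx⟩

/-! ### Announcements of derivatives -/

section Deriv

variable {s : GoalSet 𝓛 V} {y : Position} {f : Symb 𝓛}

theorem oblPos_deriv {x : Position} (hx : x ∈ oblPos q (deriv R s y f)) :
    x ∈ oblPos q s ∨ q ++ y <+: x := by
  obtain ⟨g, hg, u, z, hz, rfl⟩ := hx
  rcases mem_deriv.1 hg with ⟨h, hh, -, -, rfl⟩ | ⟨hg, -⟩ | ⟨ℓ', hℓ', i, hi, rfl⟩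
  · rcases mem_reduce.1 hz with ⟨hx, hne⟩ | ⟨v', i, hv', hi, hu, hup, rfl⟩
    · exact .inl ⟨h, hh, u, z, hx, rfl⟩
    · exact .inr (by simp)
  · exact .inl ⟨g, hg, u, z, hz, rfl⟩
  · simp only [freshGoal, Finset.mem_singleton, Prod.mk.injEq] at hz
    exact .inr (by simp [hz.2])

theorem announcements_deriv {a : 𝓛.Term V × Position}
    (ha : a ∈ announcements q (deriv R s y f)) :
    a ∈ announcements q s ∨ q ++ y <+: a.2 := by
  obtain ⟨g, hg, rfl⟩ := ha
  rcases mem_deriv.1 hg with ⟨h, hh, -, -, rfl⟩ | ⟨hg, -⟩ | ⟨ℓ', hℓ', i, hi, rfl⟩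
  · exact .inl ⟨h, hh, rfl⟩
  · exact .inl ⟨g, hg, rfl⟩
  · exact .inr (by simp [freshGoal])

/-- The goal that owns `x` may be discarded by a mismatch at `y`; the fresh goal at `x` does not
mention `y` and persists. -/
theorem StateInv.mem_oblPos_deriv (hs : StateInv R t W q s) {x : Position} (hx : x ∈ oblPos q s)
    (hne : x ≠ q ++ y) : x ∈ oblPos q (SetAutomata.deriv R s y f) := by
  obtain ⟨g, hg, u, z, hz, rfl⟩ := hx
  exact ⟨_, hs.freshGoal_mem_deriv hg hz (by simpa using hne) (hs.goal g hg).mem, g.2.1, z,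
    Finset.mem_singleton_self _, rfl⟩

theorem append_singleton_mem_oblPos_deriv {i : ℕ} (hi : i < f.1) :
    q ++ y ++ [i] ∈ oblPos q (deriv R s y f) := by
  obtain ⟨ρ, hρ⟩ := R.nonempty
  exact ⟨_, mem_deriv.2 (.inr (.inr ⟨ρ.lhs, Finset.mem_image_of_mem _ hρ, i, hi, rfl⟩)),
    ρ.lhs, y ++ [i], Finset.mem_singleton_self _, by simp⟩

/-- The pattern `a.1` at position `a.2` is completely matched when the state `s`, read at position
`q` and with label `y`, sees the symbol `f`. -/
def Announced (q : Position) (s : GoalSet 𝓛 V) (y : Position) (f : Symb 𝓛)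
    (a : 𝓛.Term V × Position) : Prop :=
  ∃ xs : Fin f.1 → V, ∃ p, (({(.func f.2 fun i => .var (xs i), y)} : Obligation 𝓛 V), (a.1, p)) ∈ s
    ∧ a.2 = q ++ p

theorem Announced.mem_announcements {a : 𝓛.Term V × Position} (h : Announced q s y f a) :
    a ∈ announcements q s := by
  obtain ⟨xs, p, hg, hp⟩ := h
  exact ⟨_, hg, Prod.ext rfl hp⟩

theorem reduce_flat {xs : Fin f.1 → V} :
    reduce ({(.func f.2 fun i => .var (xs i), y)} : Obligation 𝓛 V) f y = ∅ := by
  refine Finset.eq_empty_iff_forall_notMem.2 fun ⟨u, x⟩ hx => ?_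
  rcases mem_reduce.1 hx with ⟨h, hne⟩ | ⟨v, i, hv, hi, hu, hup, -⟩
  · simp only [Finset.mem_singleton, Prod.mk.injEq] at h
    exact hne h.2
  · simp only [Finset.mem_singleton, Prod.mk.injEq, and_true] at hv
    subst hv
    simp only [subAt_func_cons, hi, dite_true, subAt_nil, Option.some.injEq] at hu
    exact hup _ hu.symm

/-- A match that is announced leaves the state. -/
theorem StateInv.notMem_announcements_deriv (hs : StateInv R t W q s)
    {a : 𝓛.Term V × Position} (h : Announced q s y f a) :
    a ∉ announcements q (SetAutomata.deriv R s y f) := by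
  obtain ⟨xs, p, hg, hp⟩ := h
  obtain ⟨ℓ, p'⟩ := a
  dsimp only at hg hp
  subst hp
  have hinv := hs.goal _ hg
  rintro ⟨g, hg', ha⟩
  simp only [Prod.mk.injEq, List.append_cancel_left_eq] at ha
  obtain ⟨rfl, rfl⟩ := ha
  rcases mem_deriv.1 hg' with ⟨h, hh, -, hne, rfl⟩ | ⟨hg', hy⟩ | ⟨ℓ', hℓ', i, hi, rfl⟩
  -- By uniqueness the reduced goal is the announced one, whose reduct is empty, while the
  -- derivative keeps only non-empty reducts.
  · have := (hs.goal h hh).ext hinv rfl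
    rw [this] at hne
    exact hne reduce_flat
  · have := (hs.goal g hg').ext hinv rfl
    rw [this] at hy
    exact hy (Obligation.mem_pos.2 ⟨_, Finset.mem_singleton_self _⟩)
  -- A new fresh goal is announced at `y ++ [i]`, but an announcement position is a prefix of its
  -- obligation position, here `y`.
  · have := (hinv.prefix (Finset.mem_singleton_self _)).length_le
    simp [freshGoal] at this

/-- A goal whose announcement is correct is either announced or persists. -/
theorem StateInv.announced_or_mem_deriv (hs : StateInv R t W q s)
    (hf : headAt t (q ++ y) = some f) {ℓ u : 𝓛.Term V} {p : Position}
    (ha : (ℓ, p) ∈ announcements q s) (hu : subAt t p = some u) (hfit : Fits u ℓ) :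
    Announced q s y f (ℓ, p) ∨ (ℓ, p) ∈ announcements q (SetAutomata.deriv R s y f) := by
  obtain ⟨g, hg, ha⟩ := ha
  obtain ⟨rfl, rfl⟩ := Prod.mk.inj ha
  have hinv := hs.goal g hg
  by_cases hy : y ∈ Obligation.pos g.1
  · obtain ⟨v, hv⟩ := Obligation.mem_pos.1 hy
    obtain ⟨-, hvp, r, rfl, hr⟩ := (hinv.obl v y).1 hv
    obtain ⟨f', hf'⟩ := isPattern_iff_hd.1 hvp
    have hfit' := hfit r f' (headAt_eq_some_iff.2 ⟨v, hr, hf'⟩)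
    rw [← headAt_append_of_subAt hu, List.append_assoc, hf, Option.some.injEq] at hfit'
    subst hfit'
    -- An empty reduct means that this was the only obligation position and that all arguments of
    -- `v` are variables, which is the shape of an output goal.
    by_cases hne : reduce g.1 f (g.2.2 ++ r) = ∅
    · left
      have hvar : ∀ i w, subAt v [i] = some w → ∃ z, w = .var z := by
        intro i w hw
        by_contra hcon
        have : (w, g.2.2 ++ r ++ [i]) ∈ reduce g.1 f (g.2.2 ++ r) :=
          mem_reduce.2 (.inr ⟨v, i, hv, subAt_singleton_eq_some_of_hd hf' hw, hw,
            fun z hz => hcon ⟨z, hz⟩, rfl⟩)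
        simp [hne] at this
      cases v with
      | var z => simp [hd] at hf'
      | func f₀ ts =>
        simp only [hd, Option.some.injEq] at hf'
        subst hf'
        have : ∀ i, ∃ z, ts i = .var z := fun i =>
          hvar i _ (by simp [subAt_func_cons])
        choose xs hxs using this
        refine ⟨xs, g.2.2, ?_, rfl⟩
        convert hg using 1
        refine Prod.ext ?_ rfl
        ext ⟨w, z⟩
        simp only [Finset.mem_singleton, Prod.mk.injEq]
        constructor
        · rintro ⟨rfl, rfl⟩
          convert hv using 3
          funext i
          exact (hxs i).symm
        · intro hw
          obtain rfl : z = g.2.2 ++ r := by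
            by_contra hz
            have : (w, z) ∈ reduce g.1 ⟨_, f₀⟩ (g.2.2 ++ r) := mem_reduce.2 (.inl ⟨hw, hz⟩)
            simp [hne] at this
          refine ⟨?_, rfl⟩
          rw [hinv.unique hw hv]
          congr 1
          funext i
          exact hxs i
    · exact .inr ⟨_, mem_deriv.2 (.inl ⟨g, hg, ⟨v, hv, hf'⟩, hne, rfl⟩), rfl⟩
  · exact .inr ⟨g, mem_deriv.2 (.inr (.inl ⟨hg, hy⟩)), rfl⟩

/-- When a match is announced, all positions of function symbols of the pattern have been
inspected. -/
theorem StateInv.mem_of_announced (hs : StateInv R t W q s) {a : 𝓛.Term V × Position}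
    (h : Announced q s y f a) {r : Position} {f' : Symb 𝓛} (hr : headAt a.1 r = some f') :
    (a.2 ++ r ∈ W ∧ headAt t (a.2 ++ r) = some f') ∨ (a.2 ++ r = q ++ y ∧ f' = f) := by
  obtain ⟨xs, p, hg, hp⟩ := h
  obtain ⟨ℓ, p'⟩ := a
  dsimp only at hg hp hr
  subst hp
  have hinv := hs.goal _ hg
  dsimp only
  by_cases hW : q ++ p ++ r ∈ W
  · rw [List.append_assoc] at hW ⊢
    exact .inl ⟨hW, hinv.agree r f' hr hW⟩
  right
  -- `x` is the first uninspected position on the way to `q ++ p ++ r`. The pattern has a function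
  -- symbol there, so `x` is an obligation position, and `q ++ y` is the only one.
  obtain ⟨x, hx, hfr⟩ := exists_frontier_prefix hW
  obtain ⟨-, -, r₁, hr₁, hu₁⟩ := (hinv.obl _ y).1 (Finset.mem_singleton_self _)
  dsimp only at hr₁ hu₁
  have hy := hinv.frontier (Finset.mem_singleton_self _)
  rw [hr₁, ← List.append_assoc] at hy ⊢
  have hpx : q ++ p <+: x := by
    rcases List.prefix_or_prefix_of_prefix hx (List.prefix_append (q ++ p) r) with h | h
    · rw [hfr.eq_of_prefix hy (h.trans (List.prefix_append _ _))]
      exact List.prefix_append _ _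
    · exact h
  obtain ⟨r', rfl⟩ := hpx
  have hr'r : r' <+: r := by simpa using hx
  obtain ⟨f₀, hf₀⟩ : ∃ f₀, headAt ℓ r' = some f₀ := by
    by_cases h : r' = r
    · exact ⟨f', h ▸ hr⟩
    · exact exists_headAt_of_prefix_ne hr'r h (mem_dom_of_headAt hr)
  obtain ⟨w, hw, hwf⟩ := headAt_eq_some_iff.1 hf₀
  have hmem := (hinv.obl w (p ++ r')).2
    ⟨by simpa using hfr, isPattern_iff_hd.2 ⟨_, hwf⟩, r', rfl, hw⟩
  simp only [Finset.mem_singleton, Prod.mk.injEq] at hmem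
  obtain ⟨rfl, hpr⟩ := hmem
  obtain rfl : r' = r₁ := by simpa using hpr.trans hr₁
  obtain ⟨r₂, rfl⟩ := hr'r
  rw [headAt_append_of_subAt hu₁] at hr
  -- The remaining pattern is flat: strictly below its root there are only variables.
  rcases r₂ with _ | ⟨i, r₂⟩
  · simp only [headAt_nil, hd, Option.some.injEq] at hr
    exact ⟨by simp, hr.symm⟩
  · rw [headAt_func_cons] at hr
    split_ifs at hr with hi
    cases r₂ <;> simp [headAt, hd] at hr

end Deriv

end Goals

/-! ### Configuration trees: growing, pruning, and where matches are announced. -/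

section Trees

variable {𝓛 : FirstOrder.Language.{u, v}} {V : Type w} {S : Type x}

/-! ### Configuration trees of a term -/

namespace NonLinearSetAutomaton

variable (M : NonLinearSetAutomaton 𝓛 V S)

/-- `ct` is a configuration tree for the term `t`: the successor trees of each node start in the
successor configurations. -/
def Valid (t : 𝓛.Term V) : ConfTree S → Prop
  | .bud _ => True
  | .node c succs cts => succs = M.successors c t ∧ ∀ d, (cts d).root = d.1 ∧ Valid t (cts d)

variable {M} {t t' : 𝓛.Term V} {p : Position} {c : Conf S} {ct : ConfTree S}

theorem root_grow : (M.grow c t ct).root = ct.root := by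
  cases ct with
  | bud d => simp only [grow]; split_ifs with h <;> simp [ConfTree.root, h]
  | node d succs cts => rfl

theorem root_prune : (M.prune p ct).root = ct.root := by
  cases ct with
  | bud d => rfl
  | node d succs cts => simp only [prune]; split_ifs <;> rfl

theorem Valid.grow (h : M.Valid t ct) : M.Valid t (M.grow c t ct) := by
  induction ct with
  | bud d =>
    simp only [NonLinearSetAutomaton.grow]
    split_ifs with hd
    · exact ⟨rfl, fun e => ⟨rfl, trivial⟩⟩
    · trivial
  | node d succs cts ih =>
    exact ⟨h.1, fun e => ⟨root_grow.trans (h.2 e).1, ih e (h.2 e).2⟩⟩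

theorem nodes_grow_subset : (M.grow c t ct).nodes ⊆ insert c ct.nodes := by
  induction ct with
  | bud d =>
    simp only [NonLinearSetAutomaton.grow]
    split_ifs with hd <;> simp [ConfTree.nodes]
  | node d succs cts ih =>
    intro e he
    rcases he with he | he
    · exact .inr (.inl he)
    · obtain ⟨i, hi⟩ := Set.mem_iUnion.1 he
      rcases ih i hi with h | h
      · exact .inl h
      · exact .inr (.inr (Set.mem_iUnion.2 ⟨i, h⟩))

theorem nodes_subset_nodes_grow : ct.nodes ⊆ (M.grow c t ct).nodes := by
  induction ct with
  | bud d => simp [ConfTree.nodes]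
  | node d succs cts ih =>
    exact Set.union_subset_union_right _ (Set.iUnion_mono ih)

theorem mem_nodes_grow (hc : c ∈ ct.buds) : c ∈ (M.grow c t ct).nodes := by
  induction ct with
  | bud d =>
    obtain rfl : c = d := hc
    simp [NonLinearSetAutomaton.grow, ConfTree.nodes]
  | node d succs cts ih =>
    obtain ⟨i, hi⟩ := Set.mem_iUnion.1 hc
    exact .inr (Set.mem_iUnion.2 ⟨i, ih i hi⟩)

theorem nodes_grow (hc : c ∈ ct.buds) : (M.grow c t ct).nodes = ct.nodes ∪ {c} := by
  refine subset_antisymm (by simpa using nodes_grow_subset) (Set.union_subset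
    nodes_subset_nodes_grow (Set.singleton_subset_iff.2 (mem_nodes_grow hc)))

theorem mem_nodes_prune_node {d e : Conf S} {succs : Finset (Conf S)}
    {cts : {d // d ∈ succs} → ConfTree S} :
    e ∈ (M.prune p (.node d succs cts)).nodes ↔
      M.inspected d ≠ p ∧ (e = d ∨ ∃ i, e ∈ (M.prune p (cts i)).nodes) := by
  simp only [prune]
  split_ifs with h <;> simp [ConfTree.nodes, h]

theorem mem_nodes_of_mem_subtrees {ct' : ConfTree S} (h : ct' ∈ ct.subtrees) :
    ct'.nodes ⊆ ct.nodes := by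
  induction ct with
  | bud d => obtain rfl : ct' = _ := h; exact subset_rfl
  | node d succs cts ih =>
    rcases h with h | h
    · obtain rfl : ct' = _ := h; exact subset_rfl
    · obtain ⟨i, hi⟩ := Set.mem_iUnion.1 h
      exact (ih i hi).trans fun e he => .inr (Set.mem_iUnion.2 ⟨i, he⟩)

theorem nodesBelow_subset : M.nodesBelow ct p ⊆ ct.nodes :=
  Set.iUnion₂_subset fun _ h => mem_nodes_of_mem_subtrees h.1

theorem exists_of_mem_nodesBelow_node {d e : Conf S} {succs : Finset (Conf S)}
    {cts : {d // d ∈ succs} → ConfTree S} (hd : M.inspected d ≠ p)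
    (h : e ∈ M.nodesBelow (.node d succs cts) p) : ∃ i, e ∈ M.nodesBelow (cts i) p := by
  obtain ⟨ct', ⟨hct', hroot⟩, he⟩ := Set.mem_iUnion₂.1 h
  rcases hct' with h | h
  · obtain rfl : ct' = _ := h
    exact (hd hroot).elim
  · obtain ⟨i, hi⟩ := Set.mem_iUnion.1 h
    exact ⟨i, Set.mem_iUnion₂.2 ⟨ct', ⟨hi, hroot⟩, he⟩⟩

/-- The two parts cover the tree; that they share no announcement is `ConfInv.prune_disjoint`. -/
theorem nodes_subset : ct.nodes ⊆ (M.prune p ct).nodes ∪ M.nodesBelow ct p := by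
  induction ct with
  | bud d => simp [ConfTree.nodes]
  | node d succs cts ih =>
    intro e he
    by_cases hd : M.inspected d = p
    · exact .inr (Set.mem_iUnion₂.2 ⟨_, ⟨.inl rfl, hd⟩, he⟩)
    · rcases he with he | he
      · exact .inl (mem_nodes_prune_node.2 ⟨hd, .inl he⟩)
      · obtain ⟨i, hi⟩ := Set.mem_iUnion.1 he
        rcases ih i hi with h | h
        · exact .inl (mem_nodes_prune_node.2 ⟨hd, .inr ⟨i, h⟩⟩)
        · obtain ⟨ct', ⟨hct', hroot⟩, he⟩ := Set.mem_iUnion₂.1 h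
          exact .inr (Set.mem_iUnion₂.2 ⟨ct', ⟨.inr (Set.mem_iUnion.2 ⟨i, hct'⟩), hroot⟩, he⟩)

theorem nodes_prune_subset : (M.prune p ct).nodes ⊆ ct.nodes := by
  induction ct with
  | bud d => exact subset_rfl
  | node d succs cts ih =>
    intro e he
    obtain ⟨-, rfl | ⟨i, hi⟩⟩ := mem_nodes_prune_node.1 he
    · exact .inl rfl
    · exact .inr (Set.mem_iUnion.2 ⟨i, ih i hi⟩)

/-- Successors depend on the term only through the head symbol at the inspected position. -/
theorem Valid.prune (h : M.Valid t ct)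
    (ht : ∀ c ∈ (M.prune p ct).nodes, headAt t' (M.inspected c) = headAt t (M.inspected c)) :
    M.Valid t' (M.prune p ct) := by
  induction ct with
  | bud d => trivial
  | node d succs cts ih =>
    by_cases hd : M.inspected d = p
    · simp only [NonLinearSetAutomaton.prune, hd, if_true]
      trivial
    · have ht' := ht d (mem_nodes_prune_node.2 ⟨hd, .inl rfl⟩)
      have ih' := fun e => ih e (h.2 e).2 fun c hc =>
        ht c (mem_nodes_prune_node.2 ⟨hd, .inr ⟨e, hc⟩⟩)
      simp only [NonLinearSetAutomaton.prune, hd, if_false]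
      refine ⟨?_, fun e => ⟨root_prune.trans (h.2 e).1, ih' e⟩⟩
      rw [h.1, successors, successors, ht']

end NonLinearSetAutomaton

/-! ### Configurations of the constructed automaton -/

variable {R : TRS 𝓛 V} {lab : GoalSet 𝓛 V → Position} {t t' : 𝓛.Term V} {W : Set Position}
  {c d e : Conf (State R lab)}

/-- The invariant of configurations. -/
structure ConfInv (t : 𝓛.Term V) (W : Set Position) (c : Conf (State R lab)) : Prop where
  state : StateInv R t W c.2 c.1.1
  root : ∃ g ∈ c.1.1, g.2.2 = []

/-- The position that is inspected in the configuration `c`. -/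
noncomputable abbrev inspectedPos (c : Conf (State R lab)) : Position :=
  (R.nonLinearSetAutomaton lab).inspected c

/-- The announcement `a` is made in the configuration `c` for the term `t`. -/
def AnnouncedAt (t : 𝓛.Term V) (c : Conf (State R lab)) (a : 𝓛.Term V × Position) : Prop :=
  ∃ f, headAt t (inspectedPos c) = some f ∧ Announced c.2 c.1.1 (lab c.1.1) f a

theorem inspectedPos_eq (c : Conf (State R lab)) : inspectedPos c = c.2 ++ lab c.1.1 := rfl

theorem confInv_init (t : 𝓛.Term V) :
    ConfInv t ∅ ((R.nonLinearSetAutomaton lab).init, []) := by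
  have hfr : Frontier ∅ ([] : Position) :=
    ⟨by simp, fun x' h h' => (h' (List.prefix_nil.1 h)).elim⟩
  refine ⟨⟨fun x hx => hx.elim, fun g hg => ?_, fun g hg u x hx ℓ hℓ => ?_⟩, ?_⟩
  · obtain ⟨ℓ, hℓ, rfl⟩ := Finset.mem_image.1 hg
    exact .freshGoal (fun x hx => hx.elim) hfr hℓ ⟨t, by simp⟩
  · obtain ⟨ℓ', hℓ', rfl⟩ := Finset.mem_image.1 hg
    simp only [freshGoal, Finset.mem_singleton, Prod.mk.injEq] at hx
    rw [hx.2]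
    exact Finset.mem_image_of_mem _ hℓ
  · obtain ⟨ρ, hρ⟩ := R.nonempty
    exact ⟨_, Finset.mem_image_of_mem _ (Finset.mem_image_of_mem _ hρ), rfl⟩

/-- `IsLabelling` constrains the label only if a root position exists; the root goal, with its
non-empty obligation, provides one. -/
theorem ConfInv.inspected_mem (hlab : IsLabelling R lab) (h : ConfInv t W c) :
    inspectedPos c ∈ oblPos c.2 c.1.1 := by
  obtain ⟨g, hg, hroot⟩ := h.root
  obtain ⟨⟨u, x⟩, hx⟩ := (h.state.goal g hg).nonempty
  obtain ⟨g', hg', -, hp⟩ := hlab _ c.1.2 ⟨x, g, hg, hroot, Obligation.mem_pos.2 ⟨u, hx⟩⟩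
  obtain ⟨v, hv⟩ := Obligation.mem_pos.1 hp
  exact ⟨g', hg', v, _, hv, rfl⟩

theorem mem_successors {f : Symb 𝓛} (hf : headAt t (inspectedPos c) = some f) :
    d ∈ (R.nonLinearSetAutomaton lab).successors c t ↔
      ∃ K ∈ depClasses (deriv R c.1.1 (lab c.1.1) f), d.1.1 = lift K ∧ d.2 = c.2 ++ gcp K := by
  simp only [NonLinearSetAutomaton.successors]
  rw [hf]
  simp only [TRS.nonLinearSetAutomaton, TRS.setAutomaton, SetAutomaton.toNonLinear, transGoals,
    Finset.mem_image, Finset.mem_attach, true_and]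
  constructor
  · rintro ⟨_, ⟨⟨a, ha⟩, rfl⟩, rfl⟩
    obtain ⟨K, hK, rfl⟩ := Finset.mem_image.1 ha
    exact ⟨K, hK, rfl, rfl⟩
  · rintro ⟨K, hK, h₁, h₂⟩
    refine ⟨_, ⟨⟨(lift K, gcp K), Finset.mem_image_of_mem _ hK⟩, rfl⟩, ?_⟩
    exact Prod.ext (Subtype.ext h₁.symm) h₂.symm

theorem exists_headAt_of_mem_successors
    (h : d ∈ (R.nonLinearSetAutomaton lab).successors c t) :
    ∃ f, headAt t (inspectedPos c) = some f := by
  rw [← Option.ne_none_iff_exists']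
  intro hnone
  simp only [NonLinearSetAutomaton.successors] at h
  rw [hnone] at h
  simp at h

section Step

variable {f : Symb 𝓛}

/-- The successors of a configuration are the dependency classes of its derivative. -/
theorem ConfInv.exists_class (hlab : IsLabelling R lab) (h : ConfInv t W c)
    (hf : headAt t (inspectedPos c) = some f)
    (hd : d ∈ (R.nonLinearSetAutomaton lab).successors c t) :
    ∃ K ∈ depClasses (deriv R c.1.1 (lab c.1.1) f), d.1.1 = lift K ∧ d.2 = c.2 ++ gcp K ∧
      ConfInv t (insert (inspectedPos c) W) d ∧ oblPos d.2 d.1.1 = oblPos c.2 K ∧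
      announcements d.2 d.1.1 = announcements c.2 K := by
  obtain ⟨K, hK, h₁, h₂⟩ := (mem_successors hf).1 hd
  have hD := h.state.deriv (h.state.frontier (h.inspected_mem hlab)) hf
  have hKinv := hD.depClass hK
  have hleast := hD.exists_least hK
  refine ⟨K, hK, h₁, h₂, ⟨?_, ?_⟩, ?_, ?_⟩
  · rw [h₁, h₂]
    exact hKinv.lift
  · obtain ⟨g, hg, hmin⟩ := hleast
    rw [h₁]
    exact ⟨(liftObligation (gcp K) g.1, (g.2.1, [])),
      mem_lift.2 ⟨g, hg, by simp [gcp_eq hg hmin], rfl, rfl⟩, rfl⟩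
  · rw [h₁, h₂, oblPos_lift hleast hKinv]
  · rw [h₁, h₂, announcements_lift hleast]

theorem oblPos_mono (q : Position) {s s' : GoalSet 𝓛 V} (h : s ⊆ s') : oblPos q s ⊆ oblPos q s' :=
  fun _ ⟨g, hg, H⟩ => ⟨g, h hg, H⟩

theorem announcements_mono (q : Position) {s s' : GoalSet 𝓛 V} (h : s ⊆ s') :
    announcements q s ⊆ announcements q s' :=
  fun _ ⟨g, hg, H⟩ => ⟨g, h hg, H⟩

/-- Every dependency class of the derivative gives rise to a successor. -/
theorem ConfInv.exists_successor (hlab : IsLabelling R lab) (h : ConfInv t W c)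
    (hf : headAt t (inspectedPos c) = some f) {g : Goal 𝓛 V}
    (hg : g ∈ deriv R c.1.1 (lab c.1.1) f) :
    ∃ d ∈ (R.nonLinearSetAutomaton lab).successors c t, ∃ K : GoalSet 𝓛 V, g ∈ K ∧
      oblPos d.2 d.1.1 = oblPos c.2 K ∧ announcements d.2 d.1.1 = announcements c.2 K := by
  obtain ⟨K, hK, hgK⟩ := exists_mem_depClasses hg
  have hD := h.state.deriv (h.state.frontier (h.inspected_mem hlab)) hf
  have hleast := hD.exists_least hK
  have hmem : (lift K, gcp K) ∈ transGoals R lab c.1.1 f := Finset.mem_image_of_mem _ hK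
  exact ⟨(⟨lift K, c.1.2.trans hmem⟩, c.2 ++ gcp K), (mem_successors hf).2 ⟨K, hK, rfl, rfl⟩, K,
    hgK, oblPos_lift hleast (hD.depClass hK), announcements_lift hleast⟩

theorem ConfInv.successor (hlab : IsLabelling R lab) (h : ConfInv t W c)
    (hd : d ∈ (R.nonLinearSetAutomaton lab).successors c t) :
    ConfInv t (insert (inspectedPos c) W) d := by
  obtain ⟨f, hf⟩ := exists_headAt_of_mem_successors hd
  obtain ⟨K, hK, -, -, h', -, -⟩ := h.exists_class hlab hf hd
  exact h'

/-- `e` only speaks about announcements of `c` and about positions below its obligations. -/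
structure Inherits (c e : Conf (State R lab)) : Prop where
  obl : ∀ x ∈ oblPos e.2 e.1.1, ∃ z ∈ oblPos c.2 c.1.1, z <+: x
  ann : ∀ a ∈ announcements e.2 e.1.1, a ∈ announcements c.2 c.1.1 ∨
    ∃ z ∈ oblPos c.2 c.1.1, z <+: a.2

theorem Inherits.refl (c : Conf (State R lab)) : Inherits c c :=
  ⟨fun x hx => ⟨x, hx, List.prefix_rfl⟩, fun _ ha => .inl ha⟩

theorem Inherits.trans (h : Inherits c d) (h' : Inherits d e) : Inherits c e := by
  refine ⟨fun x hx => ?_, fun a ha => ?_⟩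
  · obtain ⟨z, hz, hzx⟩ := h'.obl x hx
    obtain ⟨z', hz', hzz⟩ := h.obl z hz
    exact ⟨z', hz', hzz.trans hzx⟩
  · rcases h'.ann a ha with ha | ⟨z, hz, hza⟩
    · exact h.ann a ha
    · obtain ⟨z', hz', hzz⟩ := h.obl z hz
      exact .inr ⟨z', hz', hzz.trans hza⟩

/-- New obligations and announcements arise only below the inspected position, itself an obligation
position of `c`. -/
theorem ConfInv.inherits (hlab : IsLabelling R lab) (h : ConfInv t W c)
    (hd : d ∈ (R.nonLinearSetAutomaton lab).successors c t) : Inherits c d := by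
  obtain ⟨f, hf⟩ := exists_headAt_of_mem_successors hd
  obtain ⟨K, hK, -, -, -, ho, ha⟩ := h.exists_class hlab hf hd
  refine ⟨fun x hx => ?_, fun a hx => ?_⟩
  · rw [ho] at hx
    rcases oblPos_deriv (oblPos_mono _ (subset_of_mem_depClasses hK) hx) with h' | h'
    · exact ⟨x, h', List.prefix_rfl⟩
    · exact ⟨_, h.inspected_mem hlab, h'⟩
  · rw [ha] at hx
    exact (announcements_deriv (announcements_mono _ (subset_of_mem_depClasses hK) hx)).imp_right
      fun h' => ⟨_, h.inspected_mem hlab, h'⟩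

/-- Distinct successors of a configuration have no obligation positions in common. -/
theorem ConfInv.oblPos_disjoint (hlab : IsLabelling R lab) (h : ConfInv t W c)
    (hd : d ∈ (R.nonLinearSetAutomaton lab).successors c t)
    (he : e ∈ (R.nonLinearSetAutomaton lab).successors c t) {x : Position}
    (hxd : x ∈ oblPos d.2 d.1.1) (hxe : x ∈ oblPos e.2 e.1.1) : d = e := by
  obtain ⟨f, hf⟩ := exists_headAt_of_mem_successors hd
  obtain ⟨K, hK, h₁, h₂, -, ho, -⟩ := h.exists_class hlab hf hd
  obtain ⟨K', hK', h₁', h₂', -, ho', -⟩ := h.exists_class hlab hf he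
  rw [ho] at hxd
  rw [ho'] at hxe
  obtain ⟨g, hg, u, z, hz, rfl⟩ := hxd
  obtain ⟨g', hg', u', z', hz', heq⟩ := hxe
  obtain rfl : z = z' := by simpa using heq
  obtain rfl := depClasses_eq hK hK' hg hg' hz hz'
  exact Prod.ext (Subtype.ext (h₁.trans h₁'.symm)) (h₂.trans h₂'.symm)

/-- Distinct successors of a configuration have no announcements in common. -/
theorem ConfInv.announcements_disjoint (hlab : IsLabelling R lab) (h : ConfInv t W c)
    (hd : d ∈ (R.nonLinearSetAutomaton lab).successors c t)
    (he : e ∈ (R.nonLinearSetAutomaton lab).successors c t) {a : 𝓛.Term V × Position}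
    (had : a ∈ announcements d.2 d.1.1) (hae : a ∈ announcements e.2 e.1.1) : d = e := by
  obtain ⟨f, hf⟩ := exists_headAt_of_mem_successors hd
  obtain ⟨K, hK, h₁, h₂, -, -, ho⟩ := h.exists_class hlab hf hd
  obtain ⟨K', hK', h₁', h₂', -, -, ho'⟩ := h.exists_class hlab hf he
  have hD := h.state.deriv (h.state.frontier (h.inspected_mem hlab)) hf
  rw [ho] at had
  rw [ho'] at hae
  obtain ⟨g, hg, rfl⟩ := had
  obtain ⟨g', hg', heq⟩ := hae
  have hgi := hD.goal g (subset_of_mem_depClasses hK hg)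
  have hgi' := hD.goal g' (subset_of_mem_depClasses hK' hg')
  obtain rfl : g = g' := hgi.ext hgi' (Prod.ext (by simpa using (Prod.mk.inj heq).1)
    (by simpa using (Prod.mk.inj heq).2))
  obtain ⟨⟨u, z⟩, hz⟩ := hgi.nonempty
  obtain rfl := depClasses_eq hK hK' hg hg' hz hz
  exact Prod.ext (Subtype.ext (h₁.trans h₁'.symm)) (h₂.trans h₂'.symm)

/-- Below distinct successors of a configuration there are no announcements in common. -/
theorem ConfInv.eq_of_inherits (hlab : IsLabelling R lab) (h : ConfInv t W c)
    {d' e' : Conf (State R lab)}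
    (hd : d ∈ (R.nonLinearSetAutomaton lab).successors c t)
    (he : e ∈ (R.nonLinearSetAutomaton lab).successors c t)
    (hdd : Inherits d d') (hee : Inherits e e') {W₁ W₂ : Set Position}
    (hd' : ConfInv t W₁ d') (he' : ConfInv t W₂ e') {a : 𝓛.Term V × Position}
    (had : a ∈ announcements d'.2 d'.1.1) (hae : a ∈ announcements e'.2 e'.1.1) : d = e := by
  have key : ∀ {d e e' : Conf (State R lab)} {W₂ : Set Position},
      d ∈ (R.nonLinearSetAutomaton lab).successors c t →
      e ∈ (R.nonLinearSetAutomaton lab).successors c t → Inherits e e' → ConfInv t W₂ e' →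
      a ∈ announcements e'.2 e'.1.1 → ∀ z ∈ oblPos d.2 d.1.1, z <+: a.2 → d = e := by
    intro d e e' W₂ hd he hee he' hae z hz hza
    -- An obligation position `x` of `e'` below `a.2` lies below `z` and below some obligation
    -- position `z'` of `e`. Both are on the frontier after `c`, so they coincide, and siblings
    -- share no obligation position.
    obtain ⟨x, hx, hax⟩ := he'.state.exists_oblPos hae
    obtain ⟨z', hz', hzx⟩ := hee.obl x hx
    have := ((h.successor hlab hd).state.frontier hz).eq_of_prefix_of_prefix
      ((h.successor hlab he).state.frontier hz') (hza.trans hax) hzx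
    subst this
    exact h.oblPos_disjoint hlab hd he hz hz'
  rcases hdd.ann a had with h₁ | ⟨z, hz, hza⟩
  · rcases hee.ann a hae with h₂ | ⟨z, hz, hza⟩
    · exact h.announcements_disjoint hlab hd he h₁ h₂
    · exact (key he hd hdd hd' had z hz hza).symm
  · exact key hd he hee he' hae z hz hza

/-- What is announced in a configuration is not announced below it. -/
theorem ConfInv.notMem_of_announcedAt (hlab : IsLabelling R lab) (h : ConfInv t W c)
    (hd : d ∈ (R.nonLinearSetAutomaton lab).successors c t) (hde : Inherits d e)
    {a : 𝓛.Term V × Position} (ha : AnnouncedAt t c a) : a ∉ announcements e.2 e.1.1 := by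
  intro hae
  obtain ⟨f, hf, ha⟩ := ha
  rcases hde.ann a hae with hae | ⟨z, hz, hza⟩
  · obtain ⟨K, hK, -, -, -, -, ho⟩ := h.exists_class hlab hf hd
    rw [ho] at hae
    exact h.state.notMem_announcements_deriv ha
      (announcements_mono _ (subset_of_mem_depClasses hK) hae)
  · have hd' := h.successor hlab hd
    have hy : inspectedPos c ∈ insert (inspectedPos c) W := .inl rfl
    obtain ⟨xs, p, hg, hp⟩ := ha
    -- `z` is a prefix of `a.2` and `a.2` of the inspected position, so `z` would be inspected
    -- already.
    have := (h.state.goal _ hg).prefix (Finset.mem_singleton_self _)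
    refine (hd'.state.frontier hz).1 (hd'.state.closed _ hy z (hza.trans ?_))
    rw [hp, inspectedPos_eq]
    simpa using this

/-- An announcement is correct. -/
theorem ConfInv.fits (h : ConfInv t W c) {a : 𝓛.Term V × Position} (ha : AnnouncedAt t c a) :
    ∃ u, subAt t a.2 = some u ∧ Fits u a.1 := by
  obtain ⟨f, hf, ha⟩ := ha
  have key : ∀ r f', headAt a.1 r = some f' → headAt t (a.2 ++ r) = some f' := by
    intro r f' hr
    rcases h.state.mem_of_announced ha hr with ⟨-, h'⟩ | ⟨h', rfl⟩
    · exact h'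
    · rw [h']
      exact hf
  obtain ⟨g, hg, hga⟩ := ha.mem_announcements
  obtain ⟨f₀, hf₀⟩ := isPattern_iff_hd.1 (TRS.isPattern_of_mem_lhss (h.state.goal g hg).mem)
  have ha1 : a.1 = g.2.1 := by rw [hga]
  obtain ⟨u, hu⟩ := mem_dom_of_headAt (key [] f₀ (by rwa [headAt_nil, ha1]))
  rw [List.append_nil] at hu
  exact ⟨u, hu, fun r f' hr => by rw [← headAt_append_of_subAt hu]; exact key r f' hr⟩

/-- The positions of the function symbols of an announced pattern have been inspected. -/
theorem ConfInv.mem_insert_of_announcedAt (h : ConfInv t W c) {a : 𝓛.Term V × Position}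
    (ha : AnnouncedAt t c a) {r : Position} {f' : Symb 𝓛} (hr : headAt a.1 r = some f') :
    a.2 ++ r ∈ insert (inspectedPos c) W := by
  obtain ⟨f, hf, ha⟩ := ha
  rcases h.state.mem_of_announced ha hr with ⟨h', -⟩ | ⟨h', -⟩
  · exact .inr h'
  · exact .inl h'

end Step

/-! ### Configuration trees of the constructed automaton -/

variable {ct : ConfTree (State R lab)} {p : Position}

theorem ConfInv.of_mem_nodes (hlab : IsLabelling R lab)
    (hv : (R.nonLinearSetAutomaton lab).Valid t ct) (h : ConfInv t W ct.root) (he : e ∈ ct.nodes) :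
    (∃ W', ConfInv t W' e) ∧ Inherits ct.root e := by
  induction ct generalizing W with
  | bud d => exact he.elim
  | node d succs cts ih =>
    rcases he with he | he
    · obtain rfl : e = d := he
      exact ⟨⟨W, h⟩, .refl _⟩
    · obtain ⟨i, hi⟩ := Set.mem_iUnion.1 he
      have hmem : (cts i).root ∈ (R.nonLinearSetAutomaton lab).successors d t := by
        rw [(hv.2 i).1, ← hv.1]
        exact i.2
      obtain ⟨h₁, h₂⟩ := ih i (hv.2 i).2 (ConfInv.successor hlab h hmem) hi
      exact ⟨h₁, (ConfInv.inherits hlab h hmem).trans h₂⟩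

/-- Pruned and remaining nodes have no announcements in common. -/
theorem ConfInv.prune_disjoint (hlab : IsLabelling R lab)
    (hv : (R.nonLinearSetAutomaton lab).Valid t ct) (h : ConfInv t W ct.root)
    (hd : d ∈ ((R.nonLinearSetAutomaton lab).prune p ct).nodes)
    (he : e ∈ (R.nonLinearSetAutomaton lab).nodesBelow ct p) {a : 𝓛.Term V × Position}
    (had : AnnouncedAt t d a) : ¬ AnnouncedAt t e a := by
  intro hae
  induction ct generalizing W with
  | bud c => exact hd.elim
  | node c succs cts ih =>
    have hmem : ∀ i, (cts i).root ∈ (R.nonLinearSetAutomaton lab).successors c t := by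
      intro i
      rw [(hv.2 i).1, ← hv.1]
      exact i.2
    have hcs := fun i => ConfInv.successor hlab h (hmem i)
    obtain ⟨hne, hd⟩ := NonLinearSetAutomaton.mem_nodes_prune_node.1 hd
    obtain ⟨j, hj⟩ := NonLinearSetAutomaton.exists_of_mem_nodesBelow_node hne he
    obtain ⟨⟨W₁, hW₁⟩, hie⟩ := ConfInv.of_mem_nodes hlab (hv.2 j).2 (hcs j)
      (NonLinearSetAutomaton.nodesBelow_subset hj)
    have hae' : a ∈ announcements e.2 e.1.1 := hae.choose_spec.2.mem_announcements
    -- Either `d` is the root, below which its announcement has vanished, or both nodes lie below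
    -- successors, which coincide because they share an announcement.
    rcases hd with rfl | ⟨i, hi⟩
    · exact ConfInv.notMem_of_announcedAt hlab h (hmem j) hie had hae'
    · obtain ⟨⟨W₂, hW₂⟩, hid⟩ := ConfInv.of_mem_nodes hlab (hv.2 i).2 (hcs i)
        (NonLinearSetAutomaton.nodes_prune_subset hi)
      have := ConfInv.eq_of_inherits hlab h (hmem i) (hmem j) hid hie hW₂ hW₁
        had.choose_spec.2.mem_announcements hae'
      rw [(hv.2 i).1, (hv.2 j).1] at this
      obtain rfl := Subtype.ext this
      exact ih i (hv.2 i).2 (hcs i) hi hj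

/-- On the way to a remaining node the pruned position has not been inspected. -/
theorem ConfInv.of_mem_nodes_prune (hlab : IsLabelling R lab)
    (hv : (R.nonLinearSetAutomaton lab).Valid t ct) (h : ConfInv t W ct.root) (hp : p ∉ W)
    (he : e ∈ ((R.nonLinearSetAutomaton lab).prune p ct).nodes) :
    ∃ W', ConfInv t W' e ∧ p ∉ insert (inspectedPos e) W' := by
  induction ct generalizing W with
  | bud d => exact he.elim
  | node d succs cts ih =>
    obtain ⟨hne, he⟩ := NonLinearSetAutomaton.mem_nodes_prune_node.1 he
    have hp' : p ∉ insert (inspectedPos d) W := by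
      rintro (h | h)
      · exact hne h.symm
      · exact hp h
    rcases he with rfl | ⟨i, hi⟩
    · exact ⟨W, h, hp'⟩
    · have hmem : (cts i).root ∈ (R.nonLinearSetAutomaton lab).successors d t := by
        rw [(hv.2 i).1, ← hv.1]
        exact i.2
      exact ih i (hv.2 i).2 (ConfInv.successor hlab h hmem) hp' hi

/-- The goals of the root of a tree without buds are announced if they are correct. -/
theorem exists_announcedAt_of_mem_announcements (hlab : IsLabelling R lab) (ht : IsGround t)
    (hv : (R.nonLinearSetAutomaton lab).Valid t ct) (h : ConfInv t W ct.root)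
    (hb : ct.buds = ∅) {ℓ u : 𝓛.Term V} (ha : (ℓ, p) ∈ announcements ct.root.2 ct.root.1.1)
    (hu : subAt t p = some u) (hfit : Fits u ℓ) : ∃ e ∈ ct.nodes, AnnouncedAt t e (ℓ, p) := by
  induction ct generalizing W with
  | bud d => simp [ConfTree.buds] at hb
  | node d succs cts ih =>
    obtain ⟨f, hf⟩ := ht.exists_headAt (h.state.mem_dom (h.inspected_mem hlab))
    rcases h.state.announced_or_mem_deriv hf ha hu hfit with h' | ⟨g, hg, hga⟩
    · exact ⟨d, .inl rfl, f, hf, h'⟩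
    · obtain ⟨d', hd', K, hgK, -, hann⟩ := ConfInv.exists_successor hlab h hf hg
      have hmem : d' ∈ succs := hv.1 ▸ hd'
      have hroot : (cts ⟨d', hmem⟩).root = d' := (hv.2 ⟨d', hmem⟩).1
      have hinv := ConfInv.successor hlab h hd'
      rw [← hroot] at hinv
      have hb' : (cts ⟨d', hmem⟩).buds = ∅ := by
        simp only [ConfTree.buds, Set.iUnion_eq_empty] at hb
        exact hb _
      obtain ⟨e, he, hea⟩ := ih ⟨d', hmem⟩ (hv.2 _).2 hinv hb' (by
        rw [hroot, hann]
        exact ⟨g, hgK, hga⟩)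
      exact ⟨e, .inr (Set.mem_iUnion.2 ⟨_, he⟩), hea⟩

/-- All correct announcements below the obligation positions of the root of a tree without buds
are made. -/
theorem exists_announcedAt_of_oblPos (hlab : IsLabelling R lab) (ht : IsGround t)
    (hv : (R.nonLinearSetAutomaton lab).Valid t ct) (h : ConfInv t W ct.root)
    (hb : ct.buds = ∅) {ℓ u : 𝓛.Term V} (hℓ : ℓ ∈ R.lhss) {x : Position}
    (hx : x ∈ oblPos ct.root.2 ct.root.1.1) (hxp : x <+: p)
    (hu : subAt t p = some u) (hfit : Fits u ℓ) : ∃ e ∈ ct.nodes, AnnouncedAt t e (ℓ, p) := by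
  induction ct generalizing W x with
  | bud d => simp [ConfTree.buds] at hb
  | node d succs cts ih =>
    -- The obligation above `p` is followed down the tree until it reaches `p`; there the fresh goal
    -- for `ℓ` takes over.
    by_cases hxp' : x = p
    · obtain ⟨g, hg, v, z, hz, rfl⟩ := hx
      refine exists_announcedAt_of_mem_announcements hlab ht hv h hb ?_ hu hfit
      exact ⟨_, h.state.fresh g hg v z hz ℓ hℓ, by rw [← hxp']; rfl⟩
    obtain ⟨f, hf⟩ := ht.exists_headAt (h.state.mem_dom (h.inspected_mem hlab))
    obtain ⟨x', hx', hxp''⟩ : ∃ x' ∈ oblPos d.2 (deriv R d.1.1 (lab d.1.1) f), x' <+: p := by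
      -- If `x` is inspected, the next step towards `p` is an argument place of the symbol read, as
      -- `p` is in the domain; otherwise `x` persists.
      by_cases hxy : x = inspectedPos d
      · obtain ⟨r, rfl⟩ := hxp
        rcases r with _ | ⟨i, r⟩
        · simp at hxp'
        · obtain ⟨f', hf', hi⟩ := exists_headAt_of_mem_dom_append_cons ⟨u, hu⟩
          rw [hxy] at hf'
          obtain rfl : f = f' := Option.some.inj (hf.symm.trans hf')
          refine ⟨_, append_singleton_mem_oblPos_deriv hi, r, ?_⟩
          rw [hxy, inspectedPos_eq]
          simp
      · exact ⟨x, h.state.mem_oblPos_deriv hx hxy, hxp⟩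
    obtain ⟨g, hg, hgx⟩ := hx'
    obtain ⟨d', hd', K, hgK, hobl, -⟩ := ConfInv.exists_successor hlab h hf hg
    have hmem : d' ∈ succs := hv.1 ▸ hd'
    have hroot : (cts ⟨d', hmem⟩).root = d' := (hv.2 ⟨d', hmem⟩).1
    have hinv := ConfInv.successor hlab h hd'
    rw [← hroot] at hinv
    have hb' : (cts ⟨d', hmem⟩).buds = ∅ := by
      simp only [ConfTree.buds, Set.iUnion_eq_empty] at hb
      exact hb _
    obtain ⟨e, he, hea⟩ := ih ⟨d', hmem⟩ (hv.2 _).2 hinv hb' (x := x') (by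
      rw [hroot, hobl]
      exact ⟨g, hgK, hgx⟩) hxp''
    exact ⟨e, .inr (Set.mem_iUnion.2 ⟨_, he⟩), hea⟩

end Trees

/-! ### The loop: matches found by the tree, and the invariant. -/

section Procedure

variable {𝓛 : FirstOrder.Language.{u, v}} {V : Type w}
variable {R : TRS 𝓛 V} {lab : GoalSet 𝓛 V → Position} {t t' t₀ : 𝓛.Term V} {W : Set Position}
  {c : Conf (State R lab)} {ct : ConfTree (State R lab)} {p : Position}

/-! ### Matches that are found by a configuration tree -/

/-- Some configuration in `C` announces the pattern of `a`. -/
def Found (t : 𝓛.Term V) (C : Set (Conf (State R lab))) (a : RuleAt 𝓛 V) : Prop :=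
  ∃ c ∈ C, AnnouncedAt t c (a.1.lhs, a.2)

theorem mem_matchesL {a : RuleAt 𝓛 V} :
    a ∈ (R.nonLinearSetAutomaton lab).matchesL c t ↔
      a.1 ∈ R.rules ∧ IsLinear a.1.lhs ∧ AnnouncedAt t c (a.1.lhs, a.2) := by
  constructor
  · rintro ⟨f, hf, q, ⟨h₁, ⟨xs, h₂⟩, h₃⟩, h₄⟩
    exact ⟨h₁, h₃, f, hf, xs, q, h₂, h₄⟩
  · rintro ⟨h₁, h₃, f, hf, xs, q, h₂, h₄⟩
    exact ⟨f, hf, q, ⟨h₁, ⟨xs, h₂⟩, h₃⟩, h₄⟩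

theorem mem_matchesNL {a : RuleAt 𝓛 V} :
    a ∈ (R.nonLinearSetAutomaton lab).matchesNL c t ↔
      a.1 ∈ R.rules ∧ IsNonLinear a.1.lhs ∧ AnnouncedAt t c (a.1.lhs, a.2) := by
  constructor
  · rintro ⟨f, hf, q, ⟨h₁, ⟨xs, h₂⟩, h₃⟩, h₄⟩
    exact ⟨h₁, h₃, f, hf, xs, q, h₂, h₄⟩
  · rintro ⟨h₁, h₃, f, hf, xs, q, h₂, h₄⟩
    exact ⟨f, hf, q, ⟨h₁, ⟨xs, h₂⟩, h₃⟩, h₄⟩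

theorem mem_iUnion_matchesL {a : RuleAt 𝓛 V} {C : Set (Conf (State R lab))} :
    a ∈ ⋃ c ∈ C, (R.nonLinearSetAutomaton lab).matchesL c t ↔
      a.1 ∈ R.rules ∧ IsLinear a.1.lhs ∧ Found t C a := by
  simp only [Set.mem_iUnion, mem_matchesL, Found, exists_prop]
  grind

theorem mem_iUnion_matchesNL {a : RuleAt 𝓛 V} {C : Set (Conf (State R lab))} :
    a ∈ ⋃ c ∈ C, (R.nonLinearSetAutomaton lab).matchesNL c t ↔
      a.1 ∈ R.rules ∧ IsNonLinear a.1.lhs ∧ Found t C a := by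
  simp only [Set.mem_iUnion, mem_matchesNL, Found, exists_prop]
  grind

theorem found_union_singleton {a : RuleAt 𝓛 V} {C : Set (Conf (State R lab))} :
    Found t (C ∪ {c}) a ↔ Found t C a ∨ AnnouncedAt t c (a.1.lhs, a.2) := by
  simp only [Found, Set.mem_union, Set.mem_singleton_iff]
  grind

theorem announcedAt_congr (h : headAt t' (inspectedPos c) = headAt t (inspectedPos c))
    {a : 𝓛.Term V × Position} : AnnouncedAt t' c a ↔ AnnouncedAt t c a := by
  rw [AnnouncedAt, AnnouncedAt, h]

/-- The subterm of `t` at the position of `a` is consistent with the pattern of `a`. -/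
def ConsistentAt (t : 𝓛.Term V) (a : RuleAt 𝓛 V) : Prop :=
  ∃ u, subAt t a.2 = some u ∧ IsConsistent u a.1.lhs

theorem Found.isRedex {a : RuleAt 𝓛 V} (hlab : IsLabelling R lab)
    (hv : (R.nonLinearSetAutomaton lab).Valid t ct) (h : ConfInv t ∅ ct.root)
    (ha : Found t ct.nodes a) (hc : IsLinear a.1.lhs ∨ ConsistentAt t a) : IsRedex t a.1 a.2 := by
  obtain ⟨c, hcn, hca⟩ := ha
  obtain ⟨⟨W, hW⟩, -⟩ := ConfInv.of_mem_nodes hlab hv h hcn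
  obtain ⟨u, hu, hfit⟩ := hW.fits hca
  refine ⟨u, hu, matches_iff.2 ⟨hfit, ?_⟩⟩
  rcases hc with hc | ⟨u', hu', hc⟩
  · exact hc.isConsistent u
  · rw [hu, Option.some.injEq] at hu'
    rwa [hu']

/-- The remaining nodes do not see a rewrite step at the pruned position. -/
theorem headAt_eq_of_mem_nodes_prune {ρ : Rule 𝓛 V} (hlab : IsLabelling R lab)
    (hv : (R.nonLinearSetAutomaton lab).Valid t ct) (h : ConfInv t ∅ ct.root)
    (hrw : RewritesAt ρ p t t') (hc : c ∈ ((R.nonLinearSetAutomaton lab).prune p ct).nodes) :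
    headAt t' (inspectedPos c) = headAt t (inspectedPos c) := by
  obtain ⟨W, hW, hp⟩ := h.of_mem_nodes_prune hlab hv (by simp) hc
  refine hrw.headAt_eq fun hpc => hp ?_
  exact hW.state.closed.insert (hW.state.frontier (hW.inspected_mem hlab)) _ (.inl rfl) _ hpc

/-- Remaining nodes read the same symbols before and after the step, and share no match with the
pruned nodes; so subtracting the pruned matches removes none that is still found. -/
theorem found_prune {ρ : Rule 𝓛 V} (hlab : IsLabelling R lab)
    (hv : (R.nonLinearSetAutomaton lab).Valid t ct) (h : ConfInv t ∅ ct.root)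
    (hrw : RewritesAt ρ p t t') {a : RuleAt 𝓛 V} :
    Found t' ((R.nonLinearSetAutomaton lab).prune p ct).nodes a ↔
      Found t ct.nodes a ∧ ¬ Found t ((R.nonLinearSetAutomaton lab).nodesBelow ct p) a := by
  constructor
  · rintro ⟨c, hc, hca⟩
    rw [announcedAt_congr (headAt_eq_of_mem_nodes_prune hlab hv h hrw hc)] at hca
    refine ⟨⟨c, NonLinearSetAutomaton.nodes_prune_subset hc, hca⟩, fun ⟨e, he, hea⟩ => ?_⟩
    exact h.prune_disjoint hlab hv hc he hca hea
  · rintro ⟨⟨c, hc, hca⟩, hn⟩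
    rcases NonLinearSetAutomaton.nodes_subset (M := R.nonLinearSetAutomaton lab) (p := p) hc
      with hc | hc
    · exact ⟨c, hc, (announcedAt_congr (headAt_eq_of_mem_nodes_prune hlab hv h hrw hc)).2 hca⟩
    · exact (hn ⟨c, hc, hca⟩).elim

/-- A class with a single position imposes no condition. -/
theorem IsConsistent.of_subAt_eq {ℓ s s' : 𝓛.Term V} (h : IsConsistent s ℓ)
    (heq : ∀ P ∈ varPartition ℓ, 2 ≤ P.ncard → ∀ q ∈ P, subAt s' q = subAt s q) :
    IsConsistent s' ℓ := by
  intro P hP q hq q' hq'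
  by_cases hcard : 2 ≤ P.ncard
  · rw [heq P hP hcard q hq, heq P hP hcard q' hq', h P hP q hq q' hq']
  · have hfin : P.Finite := by
      obtain ⟨r, -, rfl⟩ := hP
      exact (edge_finite ℓ).subset fun _ h => h.1
    rw [(Set.ncard_le_one hfin).1 (by omega) q hq q' hq']

/-- A rewrite step at `p` does not affect the consistency of a remaining match, unless `p` lies
below a position of a variable that occurs twice. -/
theorem consistentAt_congr {ρ : Rule 𝓛 V} (hlab : IsLabelling R lab)
    (hv : (R.nonLinearSetAutomaton lab).Valid t ct) (h : ConfInv t ∅ ct.root)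
    (hrw : RewritesAt ρ p t t') {a : RuleAt 𝓛 V}
    (ha : Found t ct.nodes a)
    (ha' : ¬ Found t ((R.nonLinearSetAutomaton lab).nodesBelow ct p) a)
    (hp : ¬ ∃ P ∈ varPartition a.1.lhs, 2 ≤ P.ncard ∧ ∃ q ∈ P, a.2 ++ q <+: p) :
    ConsistentAt t' a ↔ ConsistentAt t a := by
  obtain ⟨c, hc, hca⟩ := (found_prune hlab hv h hrw).2 ⟨ha, ha'⟩
  rw [announcedAt_congr (headAt_eq_of_mem_nodes_prune hlab hv h hrw hc)] at hca
  obtain ⟨W, hW, hpW⟩ := h.of_mem_nodes_prune hlab hv (by simp) hc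
  have hclosed := hW.state.closed.insert (hW.state.frontier (hW.inspected_mem hlab))
  have hins : ∀ r f, headAt a.1.lhs r = some f → ¬ p <+: a.2 ++ r := fun r f hr hpr =>
    hpW (hclosed _ (hW.mem_insert_of_announcedAt hca hr) _ hpr)
  obtain ⟨f₀, hf₀⟩ := isPattern_iff_hd.1 a.1.isPattern_lhs
  have hpa : ¬ p <+: a.2 := by simpa using hins [] f₀ (by simpa using hf₀)
  obtain ⟨u, hu, hfit⟩ := hW.fits hca
  obtain ⟨u', hu'⟩ : a.2 ∈ dom t' := by
    refine mem_dom_of_headAt (f := f₀) ?_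
    rw [hrw.headAt_eq hpa, ← List.append_nil a.2, headAt_append_of_subAt hu]
    exact hfit [] f₀ (by simpa using hf₀)
  have heq : ∀ P ∈ varPartition a.1.lhs, 2 ≤ P.ncard → ∀ q ∈ P, subAt u' q = subAt u q := by
    intro P hP hcard q hq
    rw [← subAt_append_of_subAt hu, ← subAt_append_of_subAt hu']
    have hqp : ¬ a.2 ++ q <+: p := fun hqp => hp ⟨P, hP, hcard, q, hq, hqp⟩
    refine hrw.subAt_eq (fun hpq => ?_) hqp
    -- If `p` is above `a.2 ++ q`, then it is above `a.2` or at a function symbol of the pattern.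
    -- Either way an inspected position lies at or below `p`, against `hins`.
    rcases List.prefix_or_prefix_of_prefix hpq (List.prefix_append a.2 q) with h' | ⟨r, rfl⟩
    · exact hpa h'
    · have hrq : r <+: q := by simpa using hpq
      have hne : r ≠ q := by
        rintro rfl
        exact hqp List.prefix_rfl
      obtain ⟨z, hz⟩ : q ∈ edge a.1.lhs := by
        obtain ⟨r', -, rfl⟩ := hP
        exact hq.1
      obtain ⟨f, hf⟩ := exists_headAt_of_prefix_ne hrq hne ⟨_, hz⟩
      exact hins r f hf List.prefix_rfl
  constructor
  · rintro ⟨w, hw, hcons⟩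
    obtain rfl : u' = w := Option.some.inj (hu'.symm.trans hw)
    exact ⟨u, hu, hcons.of_subAt_eq fun P hP hcard q hq => (heq P hP hcard q hq).symm⟩
  · rintro ⟨w, hw, hcons⟩
    obtain rfl : u = w := Option.some.inj (hu.symm.trans hw)
    exact ⟨u', hu', hcons.of_subAt_eq heq⟩

/-! ### The invariant of the loop -/

/-- The invariant of the loop of `NormalizeNonLinear`. -/
structure LoopInv (t₀ : 𝓛.Term V) (m : Memory 𝓛 V (State R lab)) : Prop where
  ground : IsGround m.t
  rewrites : Relation.ReflTransGen R.Rewrites t₀ m.t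
  valid : (R.nonLinearSetAutomaton lab).Valid m.t m.ct
  root : m.ct.root = ((R.nonLinearSetAutomaton lab).init, [])
  redsL : ∀ a, a ∈ m.redsL ↔ a.1 ∈ R.rules ∧ IsLinear a.1.lhs ∧ Found m.t m.ct.nodes a
  nonLinear : ∀ a, (a ∈ m.am ∨ a ∈ m.en ∨ a ∈ m.dis) ↔
    a.1 ∈ R.rules ∧ IsNonLinear a.1.lhs ∧ Found m.t m.ct.nodes a
  en : ∀ a ∈ m.en, ConsistentAt m.t a
  dis : ∀ a ∈ m.dis, ¬ ConsistentAt m.t a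

variable {m : Memory 𝓛 V (State R lab)} {a : RuleAt 𝓛 V}

theorem LoopInv.confInv (h : LoopInv t₀ m) : ConfInv m.t ∅ m.ct.root := by
  rw [h.root]
  exact confInv_init m.t

theorem loopInv_start (ht₀ : IsGround t₀) :
    LoopInv t₀ ((R.nonLinearSetAutomaton lab).start t₀) where
  ground := ht₀
  rewrites := .refl
  valid := trivial
  root := rfl
  redsL a := by simp [NonLinearSetAutomaton.start, ConfTree.nodes, Found]
  nonLinear a := by simp [NonLinearSetAutomaton.start, ConfTree.nodes, Found]
  en a ha := ha.elim
  dis a ha := ha.elim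

theorem LoopInv.growStep (h : LoopInv t₀ m) (hc : c ∈ m.ct.buds) :
    LoopInv t₀ ((R.nonLinearSetAutomaton lab).growStep m c) where
  ground := h.ground
  rewrites := h.rewrites
  valid := h.valid.grow
  root := NonLinearSetAutomaton.root_grow.trans h.root
  redsL a := by
    simp only [NonLinearSetAutomaton.growStep, Set.mem_union, h.redsL, mem_matchesL,
      NonLinearSetAutomaton.nodes_grow hc, found_union_singleton]
    tauto
  nonLinear a := by
    have := h.nonLinear a
    simp only [NonLinearSetAutomaton.growStep, Set.mem_union, mem_matchesNL,
      NonLinearSetAutomaton.nodes_grow hc, found_union_singleton]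
    tauto
  en := h.en
  dis := h.dis

theorem LoopInv.checkStep (h : LoopInv t₀ m) (ha : a ∈ m.am) :
    LoopInv t₀ (NonLinearSetAutomaton.checkStep m a) := by
  rw [NonLinearSetAutomaton.checkStep]
  split_ifs with hc
  · refine ⟨h.ground, h.rewrites, h.valid, h.root, h.redsL, fun b => ?_, fun b hb => ?_, h.dis⟩
    · rw [← h.nonLinear b]
      by_cases hba : b = a
      · simp [hba, ha]
      · simp [hba]
    · rcases hb with hb | rfl
      · exact h.en b hb
      · exact hc
  · refine ⟨h.ground, h.rewrites, h.valid, h.root, h.redsL, fun b => ?_, h.en, fun b hb => ?_⟩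
    · rw [← h.nonLinear b]
      by_cases hba : b = a
      · simp [hba, ha]
      · simp [hba]
    · rcases hb with hb | rfl
      · exact h.dis b hb
      · exact hc

theorem LoopInv.rewriteStep (hlab : IsLabelling R lab) (h : LoopInv t₀ m)
    (ha : a ∈ m.redsL ∪ m.en) :
    LoopInv t₀ ((R.nonLinearSetAutomaton lab).rewriteStep m a) := by
  have hroot := h.confInv
  -- The selected match is a genuine redex, so `contract` is an actual rewrite step.
  obtain ⟨hR, hred⟩ : a.1 ∈ R.rules ∧ IsRedex m.t a.1 a.2 := by
    rcases ha with ha | ha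
    · obtain ⟨h₁, h₂, h₃⟩ := (h.redsL a).1 ha
      exact ⟨h₁, h₃.isRedex hlab h.valid hroot (.inl h₂)⟩
    · obtain ⟨h₁, -, h₃⟩ := (h.nonLinear a).1 (.inr (.inl ha))
      exact ⟨h₁, h₃.isRedex hlab h.valid hroot (.inr (h.en a ha))⟩
  have hrw := hred.rewritesAt_contract
  have hcons : ∀ b, b ∈ m.en ∨ b ∈ m.dis →
      (b ∉ ⋃ c ∈ (R.nonLinearSetAutomaton lab).nodesBelow m.ct a.2,
        (R.nonLinearSetAutomaton lab).matchesNL c m.t) →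
      (¬ ∃ P ∈ varPartition b.1.lhs, 2 ≤ P.ncard ∧ ∃ q ∈ P, b.2 ++ q <+: a.2) →
      (ConsistentAt (contract m.t a.1 a.2) b ↔ ConsistentAt m.t b) := by
    intro b hb hb' hp
    obtain ⟨h₁, h₂, h₃⟩ := (h.nonLinear b).1 (.inr hb)
    rw [mem_iUnion_matchesNL] at hb'
    exact consistentAt_congr hlab h.valid hroot hrw h₃ (fun h₄ => hb' ⟨h₁, h₂, h₄⟩) hp
  refine ⟨hrw.isGround h.ground, h.rewrites.tail ⟨a.1, hR, a.2, hrw⟩,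
    h.valid.prune fun c hc => headAt_eq_of_mem_nodes_prune hlab h.valid hroot hrw hc,
    NonLinearSetAutomaton.root_prune.trans h.root, fun b => ?_, fun b => ?_, fun b hb => ?_,
    fun b hb => ?_⟩
  · simp only [NonLinearSetAutomaton.rewriteStep, Set.mem_sdiff, h.redsL, mem_iUnion_matchesL,
      found_prune hlab h.valid hroot hrw]
    tauto
  · have := h.nonLinear b
    simp only [NonLinearSetAutomaton.rewriteStep, NonLinearSetAutomaton.update, Set.mem_sdiff,
      Set.mem_union, Set.mem_ofPred_eq, mem_iUnion_matchesNL, found_prune hlab h.valid hroot hrw]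
    -- The rest is propositional: non-linear matches with `Z` are dropped, and those with `X` only
    -- move within the union of `am`, `en` and `dis`.
    generalize (∃ P ∈ varPartition b.1.lhs, 2 ≤ P.ncard ∧ ∃ q ∈ P, b.2 ++ q <+: a.2) = X
    generalize Found m.t m.ct.nodes b = Y at *
    generalize Found m.t _ b = Z
    grind
  · obtain ⟨⟨hb, hb₁⟩, hb₂⟩ := hb
    exact (hcons b (.inl hb) hb₁ fun hP => hb₂ ⟨.inl ⟨hb, hb₁⟩, hP⟩).2 (h.en b hb)
  · obtain ⟨⟨hb, hb₁⟩, hb₂⟩ := hb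
    exact fun hcon => h.dis b hb
      ((hcons b (.inr hb) hb₁ fun hP => hb₂ ⟨.inr ⟨hb, hb₁⟩, hP⟩).1 hcon)

/-- Every action preserves the invariant, and one outside the pool does nothing; this makes the
strategy immaterial. -/
theorem LoopInv.exec (hlab : IsLabelling R lab) (h : LoopInv t₀ m)
    (α : Action 𝓛 V (State R lab)) : LoopInv t₀ ((R.nonLinearSetAutomaton lab).exec m α) := by
  rcases α with c | a
  · simp only [NonLinearSetAutomaton.exec]
    split_ifs with hc
    · exact h.growStep hc
    · exact h
  · simp only [NonLinearSetAutomaton.exec]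
    split_ifs with h₁ h₂
    · exact h.checkStep h₁
    · exact h.rewriteStep hlab h₂
    · exact h

/-- When the loop ends, the current term has no redexes. -/
theorem LoopInv.inNormalForm (hlab : IsLabelling R lab) (h : LoopInv t₀ m) (hg : ¬ m.Guard) :
    R.InNormalForm m.t := by
  simp only [Memory.Guard, not_or, Set.not_nonempty_iff_eq_empty] at hg
  obtain ⟨hb, hr, hen, ham⟩ := hg
  rintro ρ hρ p ⟨u, hu, hmatch⟩
  obtain ⟨hfit, hcons⟩ := matches_iff.1 hmatch
  have hroot := h.confInv
  have hfound : Found m.t m.ct.nodes (ρ, p) := by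
    -- The initial state has the obligation position `[]`, a prefix of every `p`.
    refine exists_announcedAt_of_oblPos hlab h.ground h.valid hroot hb
      (Finset.mem_image_of_mem _ hρ) (x := []) ?_ List.nil_prefix hu hfit
    rw [h.root]
    exact ⟨_, Finset.mem_image_of_mem _ (Finset.mem_image_of_mem _ hρ), ρ.lhs, [],
      Finset.mem_singleton_self _, rfl⟩
  rcases isLinear_or_isNonLinear ρ.lhs with hl | hl
  · have := (h.redsL (ρ, p)).2 ⟨hρ, hl, hfound⟩
    simp [hr] at this
  · have := (h.nonLinear (ρ, p)).2 ⟨hρ, hl, hfound⟩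
    -- Only `dis` may be non-empty on exit, and its members are inconsistent.
    simp only [ham, hen, Set.mem_empty_iff_false, false_or] at this
    exact h.dis _ this ⟨u, hu, hcons⟩

end Procedure

end SetAutomata

theorem mainTheorem4 {𝓛 : FirstOrder.Language.{u, v}} [Finite (Symb 𝓛)] {V : Type w}
    (R : TRS 𝓛 V) (lab : GoalSet 𝓛 V → Position) (hlab : IsLabelling R lab)
    (select : Strategy 𝓛 V (State R lab)) (t₀ t : 𝓛.Term V) (ht₀ : IsGround t₀)
    (hret : (R.nonLinearSetAutomaton lab).NormalizeNonLinearReturns select t₀ t) :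
    R.IsNormalFormOf t t₀ := by
  obtain ⟨m, hm, hg, rfl⟩ := hret
  have hinv : LoopInv t₀ m := by
    clear hg
    induction hm with
    | refl => exact loopInv_start ht₀
    | tail _ h ih =>
      obtain ⟨-, α, -, rfl⟩ := h
      exact ih.exec hlab α
  exact ⟨hinv.rewrites, hinv.inNormalForm hlab hg⟩
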